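/- **Setting.** Let $\mathcal Y,\mathcal Z$ be countable alphabets and let $W(y,z\mid x,\theta)$, $x,\theta\in\{0,1\}$, be a discrete memoryless channel with marginals $P^x_\theta(y)=\sum_z W(y,z\mid x,\theta)$ and $Q^x_\theta(z)=\sum_y W(y,z\mid x,\theta)$. The changepoint $\Gamma$ has the geometric law $\mathbb P(\Gamma=k)=\pi_k=\rho(1-\rho)^{k-1}$, $k\ge 1$, with $\rho\in(0,1)$, and the channel state at time $t\ge1$ is $\theta_t=\mathbb 1\{t>\Gamma\}$. Put $d=|\ln(1-\rho)|$, $D=\mathbb D(P^1_1\|P^1_0)$, $V=\mathbb E_{Y\sim P^1_1}\big[(\ln\tfrac{P^1_1(Y)}{P^1_0(Y)})^2\big]$ and $\chi_{2,\theta}=\sum_z (Q^1_\theta(z)-Q^0_\theta(z))^2/Q^0_\theta(z)$. Assume that $Q^1_\theta\ll Q^0_\theta$, $Q^1_\theta\neq Q^0_\theta$ and $\chi_{2,\theta}<\infty$ for $\theta\in\{0,1\}$, that $P^0_1=P^0_0$, and that $0<D<\infty$ and $V<\infty$. A (causal) policy $\Pi$ consists of sensing probabilities $\beta_t(X^{t-1},Y^{t-1})\in[0,1]$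 and tests $d_t(X^{t-1},Y^{t-1})\in\{0,1\}$ with $d_1\equiv 0$. Its stopping time is $\tau=\inf\{t\ge 1: d_t=1\}$ ($\inf\emptyset=\infty$). At time $t$ the input is $X_t\sim\mathrm{Ber}(\beta_t)$ if $t<\tau$ and $X_t=0$ if $t\ge\tau$, that is, the effective sensing probability is $\bar\beta_t=\beta_t\mathbb 1\{t<\tau\}$; then $(Y_t,Z_t)\sim W(\cdot\mid X_t,\theta_t)$. Let $\mathbb P^\Pi$ be the resulting law, $\mathcal F_t=\sigma(X^{t-1},Y^{t-1})$, and $$\mathrm{ADD}(\Pi)=\mathbb E^\Pi[(\tau-\Gamma)^+],\qquad \mathrm{PFA}(\Pi)=\mathbb P^\Pi(\tau<\Gamma),\qquad \mathrm{ECB}(\Pi)=\mathbb E^\Pi\Big[\sum_{i=1}^{\tau}\chi_{2,\theta_i}\bar\beta_i^2\Big].$$ For $\delta>0$ and $\alpha\in(0,1)$ put $C_\rho=\ln\frac{1-\rho}{\rho}$, $M_{\mathrm{over}}=\frac{V+2dD+d^2}{d^2}$, $$\tilde\beta_\alpha=\sqrt{\frac{\delta}{\frac{\chi_{2,0}}{\rho}+\chi_{2,1}\Big(\frac{|\ln\alpha|-|\ln(1-\alpha)|+C_\rho}{d}+M_{\mathrm{over}}\Big)}},\qquad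 \beta^*_\alpha=\min(1,\tilde\beta_\alpha).$$ A constant-sensing-probability Shiryaev policy with parameters $(\alpha,\beta^*_\alpha)$ is a policy with $\beta_t\equiv\beta^*_\alpha$ and, almost surely, $\tau=\inf\{t\ge1:\mathbb P^\Pi(\Gamma<t\mid\mathcal F_t)\ge 1-\alpha\}$. **Theorem (Second-Order Asymptotics).** Fix $\delta>0$. Then $\tilde\beta_\alpha\sim\sqrt{\delta d/(\chi_{2,1}|\ln\alpha|)}$ as $\alpha\to0^+$, and there are constants $C$ and $\alpha_0>0$ (depending only on $W,\rho,\delta$) such that for all $\alpha\in(0,\alpha_0)$: 1. a constant-sensing-probability Shiryaev policy with parameters $(\alpha,\beta^*_\alpha)$ exists; 2. every such policy $\Pi$ satisfies $\mathrm{ECB}(\Pi)\le\delta$, $\mathrm{PFA}(\Pi)\le\alpha$, $\mathrm{ADD}(\Pi)<\infty$ and $$\mathrm{ADD}(\Pi)\le\frac{|\ln\alpha|}{d}-\frac{D\sqrt\delta}{d^{3/2}\sqrt{\chi_{2,1}}}\sqrt{|\ln\alpha|}+C;$$ 3. (matching converse) every causal policy $\Pi$ with $\mathrm{ECB}(\Pi)\le\delta$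 and $\mathrm{PFA}(\Pi)\le\alpha$ satisfies $$\mathrm{ADD}(\Pi)\ge\frac{|\ln\alpha|}{d}-\frac{D\sqrt\delta}{d^{3/2}\sqrt{\chi_{2,1}}}\sqrt{|\ln\alpha|}-C.$$ -/

import Mathlib

namespace CovertQCD

open MeasureTheory ProbabilityTheory
open scoped ENNReal

/-- A two-state, binary-input discrete memoryless channel `W x θ`: the joint PMF of the outputs
`(Y_t, Z_t)` when the input is `x` (`false` = innocent action `0`, `true` = active probe `1`)
and the channel state is `θ` (`false` = pre-change `0`, `true` = post-change `1`). -/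
abbrev Channel (Y Z : Type*) := Bool → Bool → PMF (Y × Z)

/-- Alice's observation channel `P^x_θ(y) = ∑_z W(y, z | x, θ)`. -/
noncomputable def aliceChannel {Y Z : Type*} (W : Channel Y Z) (x θ : Bool) : PMF Y :=
  (W x θ).map Prod.fst

/-- Eve's observation channel `Q^x_θ(z) = ∑_y W(y, z | x, θ)`. -/
noncomputable def eveChannel {Y Z : Type*} (W : Channel Y Z) (x θ : Bool) : PMF Z :=
  (W x θ).map Prod.snd

/-- `P ≪ Q` for PMFs. -/
def AbsCont {A : Type*} (P Q : PMF A) : Prop := ∀ a, Q a = 0 → P a = 0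

/-- `χ₂(P ‖ Q) = ∑_a (P a - Q a)² / Q a`, with values in `[0, ∞]`. It is used only for `P ≪ Q`;
points with `Q a = 0` (hence `P a = 0`) contribute `0`. -/
noncomputable def chiSq {A : Type*} (P Q : PMF A) : ℝ≥0∞ :=
  ∑' a, ENNReal.ofReal (((P a).toReal - (Q a).toReal) ^ 2 / (Q a).toReal)

/-- `𝕍(P ‖ Q) = 𝔼_{X ∼ P} [(ln (P X / Q X))²]`, with values in `[0, ∞]`; used only for `P ≪ Q`. -/
noncomputable def relVar {A : Type*} (P Q : PMF A) : ℝ≥0∞ :=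
  ∑' a, P a * ENNReal.ofReal ((Real.log ((P a).toReal / (Q a).toReal)) ^ 2)

/-- `D = 𝔻(P¹₁ ‖ P¹₀)`, with values in `[0, ∞]`. -/
noncomputable def gainD {Y Z : Type*} [MeasurableSpace Y] (W : Channel Y Z) : ℝ≥0∞ :=
  InformationTheory.klDiv (aliceChannel W true true).toMeasure
    (aliceChannel W true false).toMeasure

/-- `V = 𝕍(P¹₁ ‖ P¹₀)`, with values in `[0, ∞]`. -/
noncomputable def gainV {Y Z : Type*} (W : Channel Y Z) : ℝ≥0∞ :=
  relVar (aliceChannel W true true) (aliceChannel W true false)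

/-- `χ_{2,θ} = χ₂(Q¹_θ ‖ Q⁰_θ)`, with values in `[0, ∞]`. -/
noncomputable def chi {Y Z : Type*} (W : Channel Y Z) (θ : Bool) : ℝ≥0∞ :=
  chiSq (eveChannel W true θ) (eveChannel W false θ)

/-- `d = |ln (1 - ρ)|`. -/
noncomputable def priorExp (ρ : ℝ) : ℝ := |Real.log (1 - ρ)|

/-! ### Policies

Time runs through `t = 1, 2, …`; throughout, time `t = n + 1` is encoded by `n : ℕ`, the number
of past rounds.  A history of length `n` is the sequence `(X_1, Y_1), …, (X_n, Y_n)`. -/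

/-- Alice's causal information `(X^{t-1}, Y^{t-1})` at time `t = n + 1`. -/
abbrev Hist (Y : Type*) (n : ℕ) := Fin n → Bool × Y

/-- A causal policy: sensing probabilities `β_{n+1}(X^n, Y^n)` and tests `d_{n+1}(X^n, Y^n)`
(`true` = stop), where the test at time `1` never stops. -/
structure Policy (Y : Type*) where
  /-- `sense n h` is `β_{n+1}(h)`. -/
  sense : (n : ℕ) → Hist Y n → unitInterval
  /-- `test n h` is `d_{n+1}(h)`. -/
  test : (n : ℕ) → Hist Y n → Bool
  test_zero : ∀ h, test 0 h = false

open scoped Classical in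
/-- The effective sensing probability at time `n + 1`: it is `β_{n+1}` as long as no test up to
and including time `n + 1` has stopped, and `0` on and after the stopping time. -/
noncomputable def Policy.effSense {Y : Type*} (pol : Policy Y) (n : ℕ) (h : Hist Y n) :
    unitInterval :=
  if ∃ m, ∃ hm : m ≤ n, pol.test m (fun i => h (Fin.castLE hm i)) = true then 0 else pol.sense n h

/-! ### The law of the controlled process -/

section Law

variable {Y Z : Type*} [MeasurableSpace Y] [MeasurableSpace Z]

/-- The law of one round `(X, Y, Z)` when the active probe is sent with probability `p` and the
channel state is `θ`: `X ∼ Ber(p)` and `(Y, Z) ∼ W(· | X, θ)`. -/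
noncomputable def roundLaw (W : Channel Y Z) (p : unitInterval) (θ : Bool) :
    Measure (Bool × Y × Z) :=
  ENNReal.ofReal p • (W true θ).toMeasure.map (Prod.mk true)
    + ENNReal.ofReal (1 - p) • (W false θ).toMeasure.map (Prod.mk false)

instance (W : Channel Y Z) (p : unitInterval) (θ : Bool) :
    IsProbabilityMeasure (roundLaw W p θ) where
  measure_univ := by
    simp only [roundLaw, Measure.coe_add, Measure.coe_smul, Pi.add_apply, Pi.smul_apply,
      smul_eq_mul]
    rw [Measure.map_apply measurable_prodMk_left MeasurableSet.univ,
      Measure.map_apply measurable_prodMk_left MeasurableSet.univ]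
    simp only [Set.preimage_univ, measure_univ, mul_one]
    rw [← ENNReal.ofReal_add p.2.1 (by linarith [p.2.2])]
    simp

/-- The channel state `θ_t(k) = 𝟙{t > k}` at time `t = n + 1`. -/
def stateAt (k n : ℕ) : Bool := decide (k < n + 1)

variable [Countable Y] [Countable Z] [DiscreteMeasurableSpace Y] [DiscreteMeasurableSpace Z]

/-- The conditional law of `(X_{n+2}, Y_{n+2}, Z_{n+2})` given the rounds `1, …, n + 1`, when the
changepoint is `k` and Alice uses the policy `Π`. -/
noncomputable def roundKernel (W : Channel Y Z) (pol : Policy Y) (k n : ℕ) :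
    Kernel ((i : Finset.Iic n) → (fun _ : ℕ => Bool × Y × Z) i) (Bool × Y × Z) :=
  Kernel.ofFunOfCountable fun h =>
    roundLaw W
      (pol.effSense (n + 1) fun i : Fin (n + 1) =>
        let r := h ⟨i, Finset.mem_Iic.2 (Nat.lt_succ_iff.1 i.2)⟩
        (r.1, r.2.1))
      (stateAt k (n + 1))

instance (W : Channel Y Z) (pol : Policy Y) (k n : ℕ) :
    IsMarkovKernel (roundKernel W pol k n) where
  isProbabilityMeasure _ := by
    unfold roundKernel Kernel.ofFunOfCountable
    exact inferInstanceAs (IsProbabilityMeasure (roundLaw _ _ _))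

/-- `ℙ_k`: the law of `((X_t, Y_t, Z_t))_{t ≥ 1}` when `Γ = k` (coordinate `n` is time `n + 1`). -/
noncomputable def lawGiven (W : Channel Y Z) (pol : Policy Y) (k : ℕ) :
    Measure (ℕ → Bool × Y × Z) :=
  Kernel.trajMeasure (X := fun _ => Bool × Y × Z)
    (roundLaw W (pol.effSense 0 Fin.elim0) (stateAt k 0)) (roundKernel W pol k)

/-- `ℙ = ∑_k π_k ℙ_k`: the joint law of the changepoint `Γ` (first component) and of
`((X_t, Y_t, Z_t))_{t ≥ 1}`, with `ℙ(Γ = k) = π_k = ρ (1 - ρ)^(k - 1)` for `k = j + 1 ≥ 1`. -/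
noncomputable def law (W : Channel Y Z) (ρ : ℝ) (pol : Policy Y) :
    Measure (ℕ × (ℕ → Bool × Y × Z)) :=
  Measure.sum fun j : ℕ =>
    ENNReal.ofReal (ρ * (1 - ρ) ^ j) • (lawGiven W pol (j + 1)).map (Prod.mk (j + 1))

end Law

/-! ### Stopping times and performance metrics -/

/-- `(X^n, Y^n)` as a function of the sample point. -/
def hist {Y Z : Type*} (n : ℕ) (ω : ℕ × (ℕ → Bool × Y × Z)) : Hist Y n :=
  fun i => ((ω.2 i).1, (ω.2 i).2.1)

/-- `𝓕_t = σ(X^{t-1}, Y^{t-1})` for `t = n + 1`. -/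
abbrev info {Y Z : Type*} [MeasurableSpace Y] (n : ℕ) :
    MeasurableSpace (ℕ × (ℕ → Bool × Y × Z)) :=
  MeasurableSpace.comap (hist n) inferInstance

/-- `τ = inf {t ≥ 1 : d_t(X^{t-1}, Y^{t-1}) = 1}`, with `inf ∅ = ∞`. -/
noncomputable def Policy.stopTime {Y Z : Type*} (pol : Policy Y)
    (ω : ℕ × (ℕ → Bool × Y × Z)) : ℕ∞ :=
  sInf {t : ℕ∞ | ∃ n : ℕ, t = (n : ℕ∞) + 1 ∧ pol.test n (hist n ω) = true}

section Metrics

variable {Y Z : Type*} [MeasurableSpace Y] [MeasurableSpace Z] [Countable Y] [Countable Z]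
  [DiscreteMeasurableSpace Y] [DiscreteMeasurableSpace Z]

/-- Average detection delay `𝔼[(τ - Γ)⁺]` (subtraction in `ℕ∞` is truncated at `0`). -/
noncomputable def ADD (W : Channel Y Z) (ρ : ℝ) (pol : Policy Y) : ℝ≥0∞ :=
  ∫⁻ ω, ((pol.stopTime ω - (ω.1 : ℕ∞) : ℕ∞) : ℝ≥0∞) ∂(law W ρ pol)

/-- Probability of false alarm `ℙ(τ < Γ)`. -/
noncomputable def PFA (W : Channel Y Z) (ρ : ℝ) (pol : Policy Y) : ℝ≥0∞ :=
  law W ρ pol {ω | pol.stopTime ω < (ω.1 : ℕ∞)}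

open scoped Classical in
/-- Expected covertness budget `𝔼[∑_{i=1}^τ χ₂(Q¹_{θ_i} ‖ Q⁰_{θ_i}) β_i²]`, where `β_i` is the
effective sensing probability (zero on and after the stopping time). -/
noncomputable def ECB (W : Channel Y Z) (ρ : ℝ) (pol : Policy Y) : ℝ≥0∞ :=
  ∫⁻ ω, ∑' n : ℕ,
    (if (n : ℕ∞) + 1 ≤ pol.stopTime ω then
      chi W (stateAt ω.1 n) * ENNReal.ofReal ((pol.effSense n (hist n ω) : ℝ) ^ 2) else 0)
    ∂(law W ρ pol)

/-- The posterior `p_t = ℙ^Π(Γ < t | 𝓕_t)` at time `t = n + 1`. -/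
noncomputable def posterior (W : Channel Y Z) (ρ : ℝ) (pol : Policy Y) (n : ℕ) :
    ℕ × (ℕ → Bool × Y × Z) → ℝ :=
  condExp (info n) (law W ρ pol) ({ω | ω.1 < n + 1}.indicator fun _ => (1 : ℝ))

/-- `Π` is the constant-sensing-probability Shiryaev-type policy with sensing probability `β`
and level `α`: `β_t = β` for all `t`, and almost surely
`τ = inf {t ≥ 1 : ℙ^Π(Γ < t | 𝓕_t) ≥ 1 - α}`. -/
def IsShiryaev (W : Channel Y Z) (ρ α β : ℝ) (pol : Policy Y) : Prop :=
  (∀ n h, (pol.sense n h : ℝ) = β) ∧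
  ∀ᵐ ω ∂(law W ρ pol), pol.stopTime ω =
    sInf {t : ℕ∞ | ∃ n : ℕ, t = (n : ℕ∞) + 1 ∧ 1 - α ≤ posterior W ρ pol n ω}

/-! ### The proposed sensing rate -/

/-- `C_ρ = ln ((1 - ρ) / ρ)`. -/
noncomputable def constC (ρ : ℝ) : ℝ := Real.log ((1 - ρ) / ρ)

/-- `M_over = (V + 2 d D + d²) / d²`. -/
noncomputable def constM (W : Channel Y Z) (ρ : ℝ) : ℝ :=
  ((gainV W).toReal + 2 * priorExp ρ * (gainD W).toReal + priorExp ρ ^ 2) / priorExp ρ ^ 2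

/-- The unconstrained sensing rate `β̃_α`. -/
noncomputable def rateTilde (W : Channel Y Z) (ρ δ α : ℝ) : ℝ :=
  Real.sqrt (δ / ((chi W false).toReal / ρ + (chi W true).toReal *
    ((|Real.log α| - |Real.log (1 - α)| + constC ρ) / priorExp ρ + constM W ρ)))

/-- The proposed sensing rate `β*_α = min(1, β̃_α)`. -/
noncomputable def rateStar (W : Channel Y Z) (ρ δ α : ℝ) : ℝ := min 1 (rateTilde W ρ δ α)

/-- The second-order expansion
`|ln α| / d - (D √δ) / (d^{3/2} √χ_{2,1}) √|ln α|`. -/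
noncomputable def expansion (W : Channel Y Z) (ρ δ α : ℝ) : ℝ :=
  |Real.log α| / priorExp ρ
    - (gainD W).toReal * Real.sqrt δ
        / (priorExp ρ ^ (3 / 2 : ℝ) * Real.sqrt (chi W true).toReal) * Real.sqrt |Real.log α|

end Metrics

end CovertQCD

open CovertQCD
open scoped ENNReal Topology Asymptotics

/-!
Everything is computed on the countable spaces of histories `h = (X^n, Y^n)`. The two joint
probabilities `postWt n h = ℙ(h, Γ ≤ n)` and `preWt n h = ℙ(h, Γ > n)` satisfy a two-term
recursion, because given `Γ > n` the change occurs in round `n + 1` with probability `ρ`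
independently of the history. The delay, the false-alarm probability and the covertness budget
are sums of these weights over the histories on which the policy is still active, or has just
stopped (`ADD_eq`, `PFA_eq`, `ECB_eq`). Since passive rounds are uninformative, the ratio
`odds = postWt / preWt` does not depend on the policy, satisfies
`odds_{n+1} = (odds_n ℓ + ρ) / (1 - ρ)` with `ℓ` the likelihood ratio of the round, and determines
the posterior (`posterior_eq`).

*Converse.* The process `ln (1 + odds)` starts at `0`. In a round with sensing probability `β` its
mean grows by at most `d + β p D`, where `p` is the posterior: after division by `1 + odds`, this
is the convexity of `x ln x` (`one_add_mul_log_le`). At the stopping time `1 / (1 + odds)` has mean at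
most `α / (1 - ρ)`, so by Jensen's inequality `ln (1 + odds)` has mean at least `|ln α| - d`. Hence
`|ln α| ≤ d ADD + D 𝔼[∑ β_t 𝟙{Γ < t < τ}] + O(1)`, and weighing `β` against `β²` bounds the second
term by the covertness budget and the delay (`delay_converse`), which yields the expansion.

*Achievability.* After the change, `ln odds` dominates a random walk with i.i.d. steps of mean
`d + β D` and bounded second moment, started at `-C_ρ`. A Lyapunov function that is linear up to a
bounded convex correction (`exists_lyapunov`) bounds its mean first passage time over a level `b`
by `(b + O(1)) / (d + β D)`, the `O(1)` being uniform in `β`. With `β = β*_α → 0` and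
`b = |ln α| + O(1)` the product `b β` tends to infinity, so this bound lies below the delay that is
built into the definition of `β̃_α` (`delay_bound_le_budget`); this gives the covertness
constraint. Expanding in `β` gives the delay (`delay_expansion_le`).
-/

namespace CovertQCD

set_option linter.unusedSectionVars false

open MeasureTheory ProbabilityTheory InformationTheory

variable {Y Z : Type*}

/-! ### The law of a history -/

/-- The probability of the pair `(X, Y) = r` in one round, when the probe is sent with
probability `p` and the channel state is `θ`. -/
noncomputable def stepWt (W : Channel Y Z) (p : unitInterval) (θ : Bool) (r : Bool × Y) : ℝ≥0∞ :=
  ENNReal.ofReal (if r.1 then (p : ℝ) else 1 - p) * aliceChannel W r.1 θ r.2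

/-- The probability of the history `h` when the changepoint is `k`. -/
noncomputable def histWt (W : Channel Y Z) (pol : Policy Y) (k : ℕ) : (n : ℕ) → Hist Y n → ℝ≥0∞
  | 0, _ => 1
  | n + 1, h => histWt W pol k n (Fin.init h) *
      stepWt W (pol.effSense n (Fin.init h)) (stateAt k n) (h (Fin.last n))

/-- The history `(X^n, Y^n)` read off a trajectory. -/
def pathHist (n : ℕ) (x : ℕ → Bool × Y × Z) : Hist Y n := fun i => ((x i).1, (x i).2.1)

section
variable [MeasurableSpace Y] [MeasurableSpace Z] [Countable Y] [Countable Z]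
  [DiscreteMeasurableSpace Y] [DiscreteMeasurableSpace Z]

lemma measurable_pathHist (n : ℕ) : Measurable (pathHist n : (ℕ → Bool × Y × Z) → Hist Y n) := by
  unfold pathHist; fun_prop

/-- One round of `roundLaw`, restricted to Alice's part `(X, Y)`. -/
lemma roundLaw_apply (W : Channel Y Z) (p : unitInterval) (θ : Bool) (r : Bool × Y) :
    roundLaw W p θ {s | (s.1, s.2.1) = r} = stepWt W p θ r := by
  obtain ⟨b, y⟩ := r
  have h : ∀ x : Bool, aliceChannel W x θ y = (W x θ).toMeasure (Prod.fst ⁻¹' {y}) := by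
    intro x
    rw [aliceChannel, ← PMF.toMeasure_map_apply _ _ _ measurable_fst (measurableSet_singleton y),
      PMF.toMeasure_apply_singleton _ _ (measurableSet_singleton y)]
  simp only [roundLaw, Measure.coe_add, Measure.coe_smul, Pi.add_apply, Pi.smul_apply,
      smul_eq_mul, stepWt]
  rw [Measure.map_apply measurable_prodMk_left (MeasurableSet.of_discrete),
    Measure.map_apply measurable_prodMk_left (MeasurableSet.of_discrete), h]
  cases b
  · have h1 : (Prod.mk true ⁻¹' {s : Bool × Y × Z | (s.1, s.2.1) = (false, y)}) = ∅ := by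
      ext; simp
    have h2 : (Prod.mk false ⁻¹' {s : Bool × Y × Z | (s.1, s.2.1) = (false, y)})
        = Prod.fst ⁻¹' {y} := by ext; simp
    rw [h1, h2]; simp
  · have h1 : (Prod.mk false ⁻¹' {s : Bool × Y × Z | (s.1, s.2.1) = (true, y)}) = ∅ := by
      ext; simp
    have h2 : (Prod.mk true ⁻¹' {s : Bool × Y × Z | (s.1, s.2.1) = (true, y)})
        = Prod.fst ⁻¹' {y} := by ext; simp
    rw [h1, h2]; simp

instance (W : Channel Y Z) (pol : Policy Y) (k : ℕ) : IsProbabilityMeasure (lawGiven W pol k) := by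
  unfold lawGiven; infer_instance

/-- The first coordinate of a trajectory has the initial law. -/
lemma map_zero_trajMeasure {X : Type*} [MeasurableSpace X] (μ₀ : Measure X)
    [IsProbabilityMeasure μ₀]
    (κ : (n : ℕ) → Kernel ((i : Finset.Iic n) → (fun _ : ℕ => X) i) X)
    [∀ n, IsMarkovKernel (κ n)] :
    (Kernel.trajMeasure (X := fun _ => X) μ₀ κ).map (fun x => x 0) = μ₀ := by
  have h0 : (fun x : ℕ → X => x 0) =
    (fun y : (i : Finset.Iic 0) → (fun _ : ℕ => X) i => y ⟨0, by simp⟩) ∘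
      Preorder.frestrictLe (π := fun _ : ℕ => X) 0 := rfl
  rw [h0, ← Measure.map_map (by fun_prop) (by fun_prop), Kernel.trajMeasure,
    Measure.map_comp _ _ (by fun_prop), Kernel.traj_map_frestrictLe, Kernel.partialTraj_self,
    Measure.id_comp, Measure.map_map (by fun_prop) (by fun_prop)]
  convert Measure.map_id
  ext x
  rfl

lemma lawGiven_pathHist (W : Channel Y Z) (pol : Policy Y) (k n : ℕ) (h : Hist Y n) :
    lawGiven W pol k {x | pathHist n x = h} = histWt W pol k n h := by
  induction n with
  | zero =>
    have : {x : ℕ → Bool × Y × Z | pathHist 0 x = h} = Set.univ := by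
      ext x; simp [eq_iff_true_of_subsingleton]
    rw [this, measure_univ, histWt]
  | succ n ih =>
    have hset : {x : ℕ → Bool × Y × Z | pathHist (n + 1) x = h} =
        {x | pathHist n x = Fin.init h ∧ ((x n).1, (x n).2.1) = h (Fin.last n)} := by
      ext x
      simp only [Set.mem_ofPred_eq]
      constructor
      · rintro rfl; exact ⟨rfl, rfl⟩
      · rintro ⟨h1, h2⟩
        rw [← Fin.snoc_init_self h, ← h1, ← h2, ← Fin.snoc_init_self (pathHist (n + 1) x)]
        rfl
    rw [hset, histWt, ← ih]
    -- the first round has the initial law, every later round is drawn from its kernel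
    cases n with
    | zero =>
      have hs : {x : ℕ → Bool × Y × Z | pathHist 0 x = Fin.init h ∧
          ((x 0).1, (x 0).2.1) = h (Fin.last 0)} =
          (fun x => x 0) ⁻¹' {s | (s.1, s.2.1) = h (Fin.last 0)} := by
        ext x; simp [eq_iff_true_of_subsingleton]
      have hs' : {x : ℕ → Bool × Y × Z | pathHist 0 x = Fin.init h} = Set.univ := by
        ext x; simp [eq_iff_true_of_subsingleton]
      rw [hs, hs', measure_univ, one_mul, ← Measure.map_apply (measurable_pi_apply 0)
        MeasurableSet.of_discrete, lawGiven, map_zero_trajMeasure, roundLaw_apply]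
      rw [Subsingleton.elim (Fin.init h) Fin.elim0]
    | succ n =>
      let H : ((i : Finset.Iic n) → (fun _ : ℕ => Bool × Y × Z) i) → Hist Y (n + 1) :=
        fun g i => let r := g ⟨i, Finset.mem_Iic.2 (Nat.lt_succ_iff.1 i.2)⟩
          (r.1, r.2.1)
      let f : (ℕ → Bool × Y × Z) →
          ((i : Finset.Iic n) → (fun _ : ℕ => Bool × Y × Z) i) × (Bool × Y × Z) :=
        fun x => (Preorder.frestrictLe (π := fun _ : ℕ => Bool × Y × Z) n x, x (n + 1))
      have hf : Measurable f := by fun_prop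
      let A : Set (((i : Finset.Iic n) → (fun _ : ℕ => Bool × Y × Z) i) × (Bool × Y × Z)) :=
        {q | H q.1 = Fin.init h ∧ (q.2.1, q.2.2.1) = h (Fin.last (n + 1))}
      have hA : MeasurableSet A := MeasurableSet.of_discrete
      have hs : {x : ℕ → Bool × Y × Z | pathHist (n + 1) x = Fin.init h ∧
          ((x (n + 1)).1, (x (n + 1)).2.1) = h (Fin.last (n + 1))} = f ⁻¹' A := rfl
      have hs' : {x : ℕ → Bool × Y × Z | pathHist (n + 1) x = Fin.init h} =
        (Preorder.frestrictLe (π := fun _ : ℕ => Bool × Y × Z) n) ⁻¹' (H ⁻¹' {Fin.init h}) := rfl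
      rw [hs, hs', ← Measure.map_apply hf hA, ← Measure.map_apply (by fun_prop)
        MeasurableSet.of_discrete, lawGiven,
        ← Kernel.map_frestrictLe_trajMeasure_compProd_eq_map_trajMeasure,
        Measure.compProd_apply hA, mul_comm, ← setLIntegral_const, ← lintegral_indicator
          MeasurableSet.of_discrete]
      refine lintegral_congr fun g => ?_
      by_cases hg : H g = Fin.init h
      · have hA' : Prod.mk g ⁻¹' A = {s | (s.1, s.2.1) = h (Fin.last (n + 1))} := by
          ext s; simp [A, hg]
        rw [hA', Set.indicator_of_mem (by exact hg), ← roundLaw_apply, ← hg]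
        rfl
      · have hA' : Prod.mk g ⁻¹' A = ∅ := by
          ext s; simp [A, hg]
        rw [hA', Set.indicator_of_notMem (by exact hg)]
        simp

end

/-! ### The changepoint and the history -/

/-- The prior weight `π_{j+1} = ρ (1 - ρ)^j` of the changepoint `j + 1`. -/
noncomputable def priorWt (ρ : ℝ) (j : ℕ) : ℝ≥0∞ := ENNReal.ofReal (ρ * (1 - ρ) ^ j)

/-- The joint probability of the history `h` of length `n` and of `Γ > n`. -/
noncomputable def preWt (W : Channel Y Z) (ρ : ℝ) (pol : Policy Y) (n : ℕ) (h : Hist Y n) :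
    ℝ≥0∞ := ENNReal.ofReal ((1 - ρ) ^ n) * histWt W pol n n h

/-- The joint probability of the history `h` of length `n` and of `Γ ≤ n`. -/
noncomputable def postWt (W : Channel Y Z) (ρ : ℝ) (pol : Policy Y) (n : ℕ) (h : Hist Y n) :
    ℝ≥0∞ := ∑ j ∈ Finset.range n, priorWt ρ j * histWt W pol (j + 1) n h

/-- All changepoints `k ≥ n` give the same law to the first `n` rounds. -/
lemma histWt_eq_of_le (W : Channel Y Z) (pol : Policy Y) {k k' n : ℕ} (hk : n ≤ k) (hk' : n ≤ k')
    (h : Hist Y n) : histWt W pol k n h = histWt W pol k' n h := by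
  induction n with
  | zero => rfl
  | succ n ih =>
    have h1 : ∀ m, n + 1 ≤ m → stateAt m n = false := fun m hm => by
      simp only [stateAt, decide_eq_false_iff_not]; omega
    simp only [histWt, ih (by omega) (by omega) (Fin.init h), h1 k hk, h1 k' hk']

/-- Averaging over the changepoint a function that is constant from `n` on. -/
lemma tsum_priorWt_mul {ρ : ℝ} (hρ : ρ ∈ Set.Ioo (0 : ℝ) 1) (c : ℕ → ℝ≥0∞) (n : ℕ) (b : ℝ≥0∞)
    (hc : ∀ j, n ≤ j → c j = b) :
    ∑' j, priorWt ρ j * c j =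
      ∑ j ∈ Finset.range n, priorWt ρ j * c j + ENNReal.ofReal ((1 - ρ) ^ n) * b := by
  have h1 : (0 : ℝ) ≤ 1 - ρ := by linarith [hρ.2]
  rw [← Summable.sum_add_tsum_nat_add' (k := n) ENNReal.summable]
  congr 1
  have : ∀ j, priorWt ρ (j + n) * c (j + n) = priorWt ρ j * (ENNReal.ofReal ((1 - ρ) ^ n) * b) := by
    intro j
    rw [hc _ (by omega), ← mul_assoc, priorWt, priorWt, ← ENNReal.ofReal_mul (by
      have := hρ.1; positivity)]
    ring_nf
  simp_rw [this]
  rw [ENNReal.tsum_mul_right]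
  have : ∑' j, priorWt ρ j = 1 := by
    have hs : HasSum (fun j : ℕ => ρ * (1 - ρ) ^ j) 1 := by
      have := (hasSum_geometric_of_lt_one h1 (by linarith [hρ.1])).mul_left ρ
      rwa [sub_sub_cancel, mul_inv_cancel₀ hρ.1.ne'] at this
    simp only [priorWt]
    rw [← ENNReal.ofReal_tsum_of_nonneg (fun j => by have := hρ.1; positivity) hs.summable,
      hs.tsum_eq, ENNReal.ofReal_one]
  rw [this, one_mul]

lemma preWt_zero (W : Channel Y Z) (ρ : ℝ) (pol : Policy Y) (h : Hist Y 0) :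
    preWt W ρ pol 0 h = 1 := by simp [preWt, histWt]

lemma postWt_zero (W : Channel Y Z) (ρ : ℝ) (pol : Policy Y) (h : Hist Y 0) :
    postWt W ρ pol 0 h = 0 := by simp [postWt]

lemma preWt_succ (W : Channel Y Z) {ρ : ℝ} (hρ : ρ ∈ Set.Ioo (0 : ℝ) 1) (pol : Policy Y) (n : ℕ)
    (h : Hist Y (n + 1)) :
    preWt W ρ pol (n + 1) h = ENNReal.ofReal (1 - ρ) * preWt W ρ pol n (Fin.init h) *
      stepWt W (pol.effSense n (Fin.init h)) false (h (Fin.last n)) := by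
  have h1 : (0 : ℝ) ≤ 1 - ρ := by linarith [hρ.2]
  have h2 : stateAt (n + 1) n = false := by simp [stateAt]
  rw [preWt, preWt, histWt, h2, histWt_eq_of_le W pol (k' := n) (by omega) le_rfl, pow_succ,
    ENNReal.ofReal_mul (by positivity)]
  ring

lemma postWt_succ (W : Channel Y Z) {ρ : ℝ} (hρ : ρ ∈ Set.Ioo (0 : ℝ) 1) (pol : Policy Y) (n : ℕ)
    (h : Hist Y (n + 1)) :
    postWt W ρ pol (n + 1) h =
      postWt W ρ pol n (Fin.init h) *
        stepWt W (pol.effSense n (Fin.init h)) true (h (Fin.last n)) +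
      ENNReal.ofReal ρ * preWt W ρ pol n (Fin.init h) *
        stepWt W (pol.effSense n (Fin.init h)) false (h (Fin.last n)) := by
  have h1 : (0 : ℝ) ≤ 1 - ρ := by linarith [hρ.2]
  rw [postWt, Finset.sum_range_succ, postWt, Finset.sum_mul, preWt]
  congr 1
  · refine Finset.sum_congr rfl fun j hj => ?_
    have h2 : stateAt (j + 1) n = true := by
      have := Finset.mem_range.1 hj
      simp only [stateAt, decide_eq_true_eq]; omega
    rw [histWt, h2, mul_assoc]
  · have h2 : stateAt (n + 1) n = false := by simp [stateAt]
    rw [histWt, h2, histWt_eq_of_le W pol (k' := n) (by omega) le_rfl, priorWt,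
      ENNReal.ofReal_mul hρ.1.le]
    ring

/-! ### Stopping -/

/-- No test up to time `n + 1` has stopped on the history `h` of length `n`. -/
def Policy.Alive (pol : Policy Y) (n : ℕ) (h : Hist Y n) : Prop :=
  ∀ m, ∀ hm : m ≤ n, pol.test m (fun i => h (Fin.castLE hm i)) = false

/-- The policy stops exactly at time `n + 2` on the history `h` of length `n + 1`. -/
def Policy.StopAt (pol : Policy Y) (n : ℕ) (h : Hist Y (n + 1)) : Prop :=
  pol.Alive n (Fin.init h) ∧ ¬ pol.Alive (n + 1) h

lemma Policy.alive_zero (pol : Policy Y) (h : Hist Y 0) : pol.Alive 0 h := by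
  intro m hm
  obtain rfl : m = 0 := by omega
  exact pol.test_zero _

lemma Policy.alive_succ (pol : Policy Y) (n : ℕ) (h : Hist Y (n + 1)) :
    pol.Alive (n + 1) h ↔ pol.Alive n (Fin.init h) ∧ pol.test (n + 1) h = false := by
  constructor
  · intro H
    exact ⟨fun m hm => H m (by omega), H (n + 1) le_rfl⟩
  · rintro ⟨H1, H2⟩ m hm
    rcases Nat.lt_or_ge m (n + 1) with h' | h'
    · exact H1 m (by omega)
    · obtain rfl : m = n + 1 := by omega
      exact H2

lemma Policy.effSense_of_alive {pol : Policy Y} {n : ℕ} {h : Hist Y n} (H : pol.Alive n h) :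
    pol.effSense n h = pol.sense n h := by
  rw [Policy.effSense, if_neg]
  rintro ⟨m, hm, h1⟩
  exact absurd (H m hm) (by simp [h1])

lemma Policy.effSense_of_not_alive {pol : Policy Y} {n : ℕ} {h : Hist Y n}
    (H : ¬ pol.Alive n h) : pol.effSense n h = 0 := by
  rw [Policy.effSense, if_pos]
  simpa [Policy.Alive] using H

/-- The first time `m + 1` with `p m` is later than `n + 1` when `p` fails up to `n`. -/
lemma lt_sInf_time_iff (p : ℕ → Prop) (n : ℕ) :
    (n : ℕ∞) + 1 < sInf {t : ℕ∞ | ∃ m : ℕ, t = (m : ℕ∞) + 1 ∧ p m} ↔ ∀ m ≤ n, ¬ p m := by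
  constructor
  · intro H m hm hp
    have h1 : sInf {t : ℕ∞ | ∃ m : ℕ, t = (m : ℕ∞) + 1 ∧ p m} ≤ (m : ℕ∞) + 1 :=
      sInf_le ⟨m, rfl, hp⟩
    have h2 : (m : ℕ∞) + 1 ≤ (n : ℕ∞) + 1 := by gcongr
    exact absurd (lt_of_lt_of_le H (h1.trans h2)) (lt_irrefl _)
  · intro H
    have h1 : ((n + 2 : ℕ) : ℕ∞) ≤ sInf {t : ℕ∞ | ∃ m : ℕ, t = (m : ℕ∞) + 1 ∧ p m} := by
      refine le_sInf ?_
      rintro t ⟨m, rfl, hp⟩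
      have : n < m := by
        by_contra hcon
        exact H m (by omega) hp
      exact_mod_cast (by omega : n + 2 ≤ m + 1)
    refine lt_of_lt_of_le ?_ h1
    exact_mod_cast (by omega : n + 1 < n + 2)

lemma Policy.lt_stopTime_iff (pol : Policy Y) (n : ℕ) (ω : ℕ × (ℕ → Bool × Y × Z)) :
    (n : ℕ∞) + 1 < pol.stopTime ω ↔ pol.Alive n (hist n ω) := by
  rw [Policy.stopTime, lt_sInf_time_iff (fun n => pol.test n (hist n ω) = true)]
  simp only [Policy.Alive, Bool.not_eq_true]
  exact Iff.rfl

lemma Policy.stopTime_eq_iff (pol : Policy Y) (n : ℕ) (ω : ℕ × (ℕ → Bool × Y × Z)) :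
    pol.stopTime ω = (n : ℕ∞) + 2 ↔ pol.StopAt n (hist (n + 1) ω) := by
  have h1 : Fin.init (hist (n + 1) ω) = hist n ω := rfl
  rw [Policy.StopAt, h1, ← pol.lt_stopTime_iff, ← pol.lt_stopTime_iff]
  cases pol.stopTime ω with
  | top => simp; exact (by exact_mod_cast ENat.natCast_ne_top (n + 2) : ((n : ℕ∞) + 2) ≠ ⊤).symm
  | coe t => norm_cast; omega

lemma one_lt_stopTime (pol : Policy Y) (ω : ℕ × (ℕ → Bool × Y × Z)) : 1 < pol.stopTime ω := by
  have := (pol.lt_stopTime_iff 0 ω).2 (pol.alive_zero _)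
  simpa using this

/-! ### Performance metrics as sums over histories -/

section
variable [MeasurableSpace Y] [MeasurableSpace Z] [Countable Y] [Countable Z]
  [DiscreteMeasurableSpace Y] [DiscreteMeasurableSpace Z]

lemma measurable_hist (n : ℕ) :
    Measurable (hist n : ℕ × (ℕ → Bool × Y × Z) → Hist Y n) := by
  unfold hist; fun_prop

lemma measurable_comp_hist {E : Type*} [MeasurableSpace E] (n : ℕ) (g : ℕ → Hist Y n → E) :
    Measurable fun ω : ℕ × (ℕ → Bool × Y × Z) => g ω.1 (hist n ω) := by
  have h1 : Measurable (Function.uncurry g) := Measurable.of_discrete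
  exact h1.comp (measurable_fst.prodMk (measurable_hist n))

lemma lintegral_lawGiven (W : Channel Y Z) (pol : Policy Y) (k n : ℕ) (g : Hist Y n → ℝ≥0∞) :
    ∫⁻ x, g (pathHist n x) ∂(lawGiven W pol k) = ∑' h, histWt W pol k n h * g h := by
  rw [← lintegral_map (f := g) Measurable.of_discrete (measurable_pathHist n), lintegral_countable']
  refine tsum_congr fun h => ?_
  rw [Measure.map_apply (measurable_pathHist n) MeasurableSet.of_discrete, mul_comm,
    ← lawGiven_pathHist]
  rfl

lemma lintegral_law_eq_tsum (W : Channel Y Z) (ρ : ℝ) (pol : Policy Y)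
    {f : ℕ × (ℕ → Bool × Y × Z) → ℝ≥0∞} (hf : Measurable f) :
    ∫⁻ ω, f ω ∂(law W ρ pol) = ∑' j, priorWt ρ j * ∫⁻ x, f (j + 1, x) ∂(lawGiven W pol (j + 1)) := by
  rw [law, lintegral_sum_measure]
  refine tsum_congr fun j => ?_
  rw [lintegral_smul_measure, lintegral_map hf measurable_prodMk_left]
  rfl

lemma lintegral_law (W : Channel Y Z) (ρ : ℝ) (pol : Policy Y) (n : ℕ)
    (g : ℕ → Hist Y n → ℝ≥0∞) :
    ∫⁻ ω, g ω.1 (hist n ω) ∂(law W ρ pol) =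
      ∑' h, ∑' j, priorWt ρ j * (histWt W pol (j + 1) n h * g (j + 1) h) := by
  rw [lintegral_law_eq_tsum W ρ pol (measurable_comp_hist n g), ENNReal.tsum_comm]
  refine tsum_congr fun j => ?_
  rw [ENNReal.tsum_mul_left]
  congr 1
  exact lintegral_lawGiven W pol (j + 1) n (g (j + 1))

/-- Expectation of a function of the history `(X^n, Y^n)` and of the event `Γ ≤ n`. -/
lemma lintegral_law_ite (W : Channel Y Z) {ρ : ℝ} (hρ : ρ ∈ Set.Ioo (0 : ℝ) 1) (pol : Policy Y)
    (n : ℕ) (a b : Hist Y n → ℝ≥0∞) :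
    ∫⁻ ω, (if ω.1 ≤ n then a (hist n ω) else b (hist n ω)) ∂(law W ρ pol) =
      ∑' h, (postWt W ρ pol n h * a h + preWt W ρ pol n h * b h) := by
  rw [lintegral_law W ρ pol n (fun k h => if k ≤ n then a h else b h)]
  refine tsum_congr fun h => ?_
  rw [tsum_priorWt_mul hρ _ n (histWt W pol n n h * b h)]
  · rw [postWt, Finset.sum_mul, preWt, mul_assoc]
    congr 1
    refine Finset.sum_congr rfl fun j hj => ?_
    have := Finset.mem_range.1 hj
    rw [if_pos (by omega), mul_assoc]
  · intro j hj
    rw [if_neg (by omega), histWt_eq_of_le W pol (k' := n) (by omega) le_rfl]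

/-- Expectation of a function of the history `(X^n, Y^n)` and of the event `Γ ≤ n + 1`: given
`Γ > n` and the history, the changepoint is `n + 1` with probability `ρ`. -/
lemma lintegral_law_ite_succ (W : Channel Y Z) {ρ : ℝ} (hρ : ρ ∈ Set.Ioo (0 : ℝ) 1)
    (pol : Policy Y) (n : ℕ) (a b : Hist Y n → ℝ≥0∞) :
    ∫⁻ ω, (if ω.1 ≤ n + 1 then a (hist n ω) else b (hist n ω)) ∂(law W ρ pol) =
      ∑' h, ((postWt W ρ pol n h + ENNReal.ofReal ρ * preWt W ρ pol n h) * a h +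
        ENNReal.ofReal (1 - ρ) * preWt W ρ pol n h * b h) := by
  have h1 : (0 : ℝ) ≤ 1 - ρ := by linarith [hρ.2]
  rw [lintegral_law W ρ pol n (fun k h => if k ≤ n + 1 then a h else b h)]
  refine tsum_congr fun h => ?_
  rw [tsum_priorWt_mul hρ _ (n + 1) (histWt W pol n n h * b h)]
  · rw [Finset.sum_range_succ, postWt, preWt, add_mul, Finset.sum_mul]
    congr 1
    · congr 1
      · refine Finset.sum_congr rfl fun j hj => ?_
        have := Finset.mem_range.1 hj
        rw [if_pos (by omega), mul_assoc]
      · rw [if_pos le_rfl, histWt_eq_of_le W pol (k' := n) (by omega) le_rfl, priorWt,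
          ENNReal.ofReal_mul hρ.1.le]
        ring
    · rw [pow_succ, ENNReal.ofReal_mul (by positivity)]
      ring
  · intro j hj
    rw [if_neg (by omega), histWt_eq_of_le W pol (k' := n) (by omega) le_rfl]

lemma isProbabilityMeasure_law (W : Channel Y Z) {ρ : ℝ} (hρ : ρ ∈ Set.Ioo (0 : ℝ) 1)
    (pol : Policy Y) : IsProbabilityMeasure (law W ρ pol) := by
  constructor
  have := lintegral_law_ite W hρ pol 0 1 1
  simpa [preWt_zero, postWt_zero] using this

open scoped Classical in
/-- The delay counts the times `n + 1` with `Γ ≤ n + 1 < τ`. -/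
lemma ADD_eq (W : Channel Y Z) {ρ : ℝ} (hρ : ρ ∈ Set.Ioo (0 : ℝ) 1) (pol : Policy Y) :
    ADD W ρ pol = ∑' n, ∑' h, if pol.Alive n h then
      postWt W ρ pol n h + ENNReal.ofReal ρ * preWt W ρ pol n h else 0 := by
  have key : ∀ᵐ ω ∂(law W ρ pol), ((pol.stopTime ω - (ω.1 : ℕ∞) : ℕ∞) : ℝ≥0∞) =
      ∑' n : ℕ, if ω.1 ≤ n + 1 then (if pol.Alive n (hist n ω) then 1 else 0) else 0 := by
    have h1 : ∀ᵐ ω ∂(law W ρ pol), ω.1 ≠ 0 := by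
      rw [ae_iff, ← lintegral_indicator_one (by measurability)]
      rw [lintegral_law_eq_tsum W ρ pol (by measurability)]
      simp [Set.indicator]
    filter_upwards [h1] with ω hω
    obtain ⟨j, hj⟩ := Nat.exists_eq_succ_of_ne_zero hω
    simp_rw [← pol.lt_stopTime_iff, hj, ← ite_and]
    cases hτ : pol.stopTime ω with
    | top =>
      have : (⊤ : ℕ∞) - ((j.succ : ℕ) : ℕ∞) = ⊤ := by simp
      rw [this, ENat.toENNReal_top]
      symm
      refine top_unique ?_
      rw [← Summable.sum_add_tsum_nat_add' (k := j) ENNReal.summable]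
      refine le_trans ?_ le_add_self
      have h3 : ∀ n : ℕ, (if j.succ ≤ n + j + 1 ∧ ((n + j : ℕ) : ℕ∞) + 1 < ⊤ then (1 : ℝ≥0∞) else 0)
          = 1 := by
        intro n
        rw [if_pos]
        refine ⟨by omega, ?_⟩
        exact_mod_cast ENat.natCast_lt_top (n + j + 1)
      simp_rw [h3]
      rw [ENNReal.tsum_const_eq_top_of_ne_zero one_ne_zero]
    | coe t =>
      have h3 : ∀ n : ℕ, (if j.succ ≤ n + 1 ∧ (n : ℕ∞) + 1 < (t : ℕ∞) then (1 : ℝ≥0∞) else 0) =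
          if n ∈ Finset.Ico j (t - 1) then 1 else 0 := by
        intro n
        congr 1
        rw [Finset.mem_Ico]
        norm_cast
        simp only [eq_iff_iff]
        omega
      simp_rw [h3]
      rw [tsum_eq_sum (s := Finset.Ico j (t - 1)) (fun b hb => if_neg hb), Finset.sum_ite_mem,
        Finset.inter_self, Finset.sum_const, Nat.card_Ico, nsmul_eq_mul, mul_one,
        ← ENat.natCast_sub]
      rw [ENat.toENNReal_coe]
      congr 1
      omega
  rw [ADD, lintegral_congr_ae key, lintegral_tsum]
  · refine tsum_congr fun n => ?_
    rw [lintegral_law_ite_succ W hρ pol n (fun h => if pol.Alive n h then 1 else 0) (fun _ => 0)]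
    refine tsum_congr fun h => ?_
    simp
  · intro n
    exact (measurable_comp_hist n (fun k h => if k ≤ n + 1 then (if pol.Alive n h then (1 : ℝ≥0∞)
      else 0) else 0)).aemeasurable

open scoped Classical in
/-- A false alarm at time `n + 2` requires `Γ > n + 2`; given `Γ > n + 1` this has probability
`1 - ρ`, independently of the history. -/
lemma PFA_eq (W : Channel Y Z) {ρ : ℝ} (hρ : ρ ∈ Set.Ioo (0 : ℝ) 1) (pol : Policy Y) :
    PFA W ρ pol = ∑' n, ∑' h : Hist Y (n + 1), if pol.StopAt n h then
      ENNReal.ofReal (1 - ρ) * preWt W ρ pol (n + 1) h else 0 := by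
  have key : ∀ ω : ℕ × (ℕ → Bool × Y × Z),
      {ω | pol.stopTime ω < (ω.1 : ℕ∞)}.indicator (1 : ℕ × (ℕ → Bool × Y × Z) → ℝ≥0∞) ω =
      ∑' n : ℕ, if ω.1 ≤ (n + 1) + 1 then 0 else
        (if pol.StopAt n (hist (n + 1) ω) then 1 else 0) := by
    intro ω
    simp_rw [← pol.stopTime_eq_iff]
    have h1 := one_lt_stopTime pol ω
    cases hτ : pol.stopTime ω with
    | top =>
      rw [Set.indicator_of_notMem (by simp [hτ])]
      symm
      rw [ENNReal.tsum_eq_zero]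
      intro n
      have : (⊤ : ℕ∞) ≠ (n : ℕ∞) + 2 := by
        exact_mod_cast (ENat.natCast_ne_top (n + 2)).symm
      simp [this]
    | coe t =>
      rw [hτ] at h1
      obtain ⟨m, rfl⟩ : ∃ m, t = m + 2 := ⟨t - 2, by
        have : 1 < t := by exact_mod_cast h1
        omega⟩
      have h3 : ∀ n : ℕ, (if ω.1 ≤ n + 1 + 1 then 0 else
          (if ((m + 2 : ℕ) : ℕ∞) = (n : ℕ∞) + 2 then (1 : ℝ≥0∞) else 0)) =
          if n = m then (if ω.1 ≤ m + 2 then 0 else 1) else 0 := by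
        intro n
        norm_cast
        split_ifs <;> first | rfl | omega
      simp_rw [h3, tsum_ite_eq]
      rw [Set.indicator_apply]
      simp only [Set.mem_ofPred_eq, hτ, Pi.one_apply]
      norm_cast
      split_ifs <;> first | rfl | omega
  have hm : ∀ n : ℕ, Measurable fun ω : ℕ × (ℕ → Bool × Y × Z) => if ω.1 ≤ (n + 1) + 1 then
      (0 : ℝ≥0∞) else (if pol.StopAt n (hist (n + 1) ω) then 1 else 0) := fun n =>
    measurable_comp_hist (n + 1) (fun k h => if k ≤ n + 1 + 1 then (0 : ℝ≥0∞) else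
      (if pol.StopAt n h then 1 else 0))
  have hms : MeasurableSet {ω : ℕ × (ℕ → Bool × Y × Z) | pol.stopTime ω < (ω.1 : ℕ∞)} := by
    rw [← measurable_indicator_const_iff (1 : ℝ≥0∞)]
    have h2 : Measurable fun ω : ℕ × (ℕ → Bool × Y × Z) => ∑' n : ℕ, if ω.1 ≤ (n + 1) + 1 then
      (0 : ℝ≥0∞) else (if pol.StopAt n (hist (n + 1) ω) then 1 else 0) := Measurable.tsum hm
    convert h2 using 1
    ext ω
    exact key ω
  rw [PFA, ← lintegral_indicator_one hms, lintegral_congr key,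
    lintegral_tsum fun n => (hm n).aemeasurable]
  refine tsum_congr fun n => ?_
  rw [lintegral_law_ite_succ W hρ pol (n + 1) (fun _ => 0)
    (fun h => if pol.StopAt n h then 1 else 0)]
  refine tsum_congr fun h => ?_
  simp

/-- Rounds after stopping contribute nothing, because the effective sensing probability is `0`. -/
lemma ECB_eq (W : Channel Y Z) {ρ : ℝ} (hρ : ρ ∈ Set.Ioo (0 : ℝ) 1) (pol : Policy Y) :
    ECB W ρ pol = ∑' n, ∑' h, (chi W true * postWt W ρ pol n h + chi W false * preWt W ρ pol n h) *
      ENNReal.ofReal ((pol.effSense n h : ℝ) ^ 2) := by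
  classical
  have key : ∀ (ω : ℕ × (ℕ → Bool × Y × Z)) (n : ℕ),
    (if (n : ℕ∞) + 1 ≤ pol.stopTime ω then
      chi W (stateAt ω.1 n) * ENNReal.ofReal ((pol.effSense n (hist n ω) : ℝ) ^ 2) else 0) =
    if ω.1 ≤ n then chi W true * ENNReal.ofReal ((pol.effSense n (hist n ω) : ℝ) ^ 2) else
      chi W false * ENNReal.ofReal ((pol.effSense n (hist n ω) : ℝ) ^ 2) := by
    intro ω n
    by_cases ha : pol.Alive n (hist n ω)
    · rw [if_pos ((pol.lt_stopTime_iff n ω).2 ha).le]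
      by_cases hn : ω.1 ≤ n
      · rw [if_pos hn]
        simp [stateAt, Nat.lt_succ_of_le hn]
      · rw [if_neg hn]
        have : ¬ ω.1 < n + 1 := by omega
        simp [stateAt, this]
    · rw [Policy.effSense_of_not_alive ha]
      simp
  rw [ECB]
  simp only [key]
  rw [lintegral_tsum]
  · refine tsum_congr fun n => ?_
    rw [lintegral_law_ite W hρ pol n
      (fun h => chi W true * ENNReal.ofReal ((pol.effSense n h : ℝ) ^ 2))
      (fun h => chi W false * ENNReal.ofReal ((pol.effSense n h : ℝ) ^ 2))]
    refine tsum_congr fun h => ?_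
    ring
  · intro n
    exact (measurable_comp_hist n (fun k h => if k ≤ n then
      chi W true * ENNReal.ofReal ((pol.effSense n h : ℝ) ^ 2)
      else chi W false * ENNReal.ofReal ((pol.effSense n h : ℝ) ^ 2))).aemeasurable

end

/-! ### Likelihood ratios and posterior odds -/

/-- The likelihood ratio `P¹₁(y) / P¹₀(y)` of an active probe. -/
noncomputable def probeRatio (W : Channel Y Z) (y : Y) : ℝ :=
  (aliceChannel W true true y).toReal / (aliceChannel W true false y).toReal

/-- The likelihood ratio of a round `(x, y)`: passive rounds are uninformative. -/
noncomputable def roundRatio (W : Channel Y Z) (r : Bool × Y) : ℝ :=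
  if r.1 then probeRatio W r.2 else 1

/-- The posterior odds `ℙ(Γ ≤ n | X^n, Y^n) / ℙ(Γ > n | X^n, Y^n)`. -/
noncomputable def odds (W : Channel Y Z) (ρ : ℝ) : (n : ℕ) → Hist Y n → ℝ
  | 0, _ => 0
  | n + 1, h => (odds W ρ n (Fin.init h) * roundRatio W (h (Fin.last n)) + ρ) / (1 - ρ)

lemma probeRatio_nonneg (W : Channel Y Z) (y : Y) : 0 ≤ probeRatio W y := by
  unfold probeRatio; positivity

lemma roundRatio_nonneg (W : Channel Y Z) (r : Bool × Y) : 0 ≤ roundRatio W r := by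
  unfold roundRatio; split_ifs
  · exact probeRatio_nonneg W _
  · exact zero_le_one

lemma odds_nonneg (W : Channel Y Z) {ρ : ℝ} (hρ : ρ ∈ Set.Ioo (0 : ℝ) 1) (n : ℕ) (h : Hist Y n) :
    0 ≤ odds W ρ n h := by
  induction n with
  | zero => exact le_rfl
  | succ n ih =>
    have h1 := ih (Fin.init h)
    have h2 := roundRatio_nonneg W (h (Fin.last n))
    have h3 : 0 ≤ 1 - ρ := by linarith [hρ.2]
    have h4 := hρ.1.le
    rw [odds]
    positivity

lemma ofReal_toReal_div_mul {A : Type*} {P Q : PMF A} (h : AbsCont P Q) (a : A) :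
    ENNReal.ofReal ((P a).toReal / (Q a).toReal) * Q a = P a := by
  by_cases hq : Q a = 0
  · rw [hq, mul_zero, h a hq]
  · rw [ENNReal.ofReal_div_of_pos (ENNReal.toReal_pos hq (Q.apply_ne_top a)),
      ENNReal.ofReal_toReal (P.apply_ne_top a), ENNReal.ofReal_toReal (Q.apply_ne_top a),
      ENNReal.div_mul_cancel hq (Q.apply_ne_top a)]

/-- The only use of `P⁰₁ = P⁰₀`: passive rounds have likelihood ratio `1`. -/
lemma stepWt_true (W : Channel Y Z) (hP : aliceChannel W false true = aliceChannel W false false)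
    (hac : AbsCont (aliceChannel W true true) (aliceChannel W true false)) (p : unitInterval)
    (r : Bool × Y) :
    stepWt W p true r = ENNReal.ofReal (roundRatio W r) * stepWt W p false r := by
  obtain ⟨x, y⟩ := r
  cases x
  · simp [stepWt, roundRatio, hP]
  · simp only [stepWt, roundRatio, if_true]
    rw [← ofReal_toReal_div_mul hac y, probeRatio]
    ring

lemma postWt_eq (W : Channel Y Z) {ρ : ℝ} (hρ : ρ ∈ Set.Ioo (0 : ℝ) 1)
    (hP : aliceChannel W false true = aliceChannel W false false)
    (hac : AbsCont (aliceChannel W true true) (aliceChannel W true false)) (pol : Policy Y)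
    (n : ℕ) (h : Hist Y n) :
    postWt W ρ pol n h = ENNReal.ofReal (odds W ρ n h) * preWt W ρ pol n h := by
  induction n with
  | zero => simp [postWt_zero, odds]
  | succ n ih =>
    have h1 := odds_nonneg W hρ n (Fin.init h)
    have h2 := roundRatio_nonneg W (h (Fin.last n))
    have h3 : 0 < 1 - ρ := by linarith [hρ.2]
    have h4 := hρ.1.le
    rw [postWt_succ W hρ, preWt_succ W hρ, ih, stepWt_true W hP hac]
    have h5 : odds W ρ (n + 1) h * (1 - ρ) =
        odds W ρ n (Fin.init h) * roundRatio W (h (Fin.last n)) + ρ := by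
      rw [odds]; field_simp
    have h6 : ENNReal.ofReal (odds W ρ (n + 1) h) * ENNReal.ofReal (1 - ρ) =
        ENNReal.ofReal (odds W ρ n (Fin.init h)) * ENNReal.ofReal (roundRatio W (h (Fin.last n)))
          + ENNReal.ofReal ρ := by
      rw [← ENNReal.ofReal_mul (odds_nonneg W hρ _ _), h5, ENNReal.ofReal_add (by positivity) h4,
        ENNReal.ofReal_mul h1]
    calc _ = (ENNReal.ofReal (odds W ρ n (Fin.init h)) *
            ENNReal.ofReal (roundRatio W (h (Fin.last n))) + ENNReal.ofReal ρ) *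
          (preWt W ρ pol n (Fin.init h) *
            stepWt W (pol.effSense n (Fin.init h)) false (h (Fin.last n))) := by ring
      _ = _ := by rw [← h6]; ring

/-- Summation over histories of length `n + 1`: the last round is summed first. -/
lemma tsum_hist_succ (n : ℕ) (F : Hist Y n → Bool × Y → ℝ≥0∞) :
    ∑' h : Hist Y (n + 1), F (Fin.init h) (h (Fin.last n)) = ∑' h, ∑' r, F h r := by
  rw [← (Fin.snocEquiv fun _ : Fin (n + 1) => Bool × Y).tsum_eq]
  rw [← ENNReal.tsum_prod, ← (Equiv.prodComm _ _).tsum_eq]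
  refine tsum_congr fun q => ?_
  obtain ⟨r, h⟩ := q
  simp [Fin.snocEquiv]

lemma tsum_stepWt_mul (W : Channel Y Z) (p : unitInterval) (θ : Bool) (g : Bool × Y → ℝ≥0∞) :
    ∑' r, stepWt W p θ r * g r =
      ENNReal.ofReal p * ∑' y, aliceChannel W true θ y * g (true, y) +
      ENNReal.ofReal (1 - p) * ∑' y, aliceChannel W false θ y * g (false, y) := by
  rw [ENNReal.tsum_prod', tsum_bool, add_comm]
  simp only [stepWt, if_true, mul_assoc, ENNReal.tsum_mul_left, Bool.false_eq_true, if_false]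

lemma tsum_stepWt (W : Channel Y Z) (p : unitInterval) (θ : Bool) :
    ∑' r, stepWt W p θ r = 1 := by
  have h := tsum_stepWt_mul W p θ (fun _ => 1)
  simp only [mul_one, PMF.tsum_coe] at h
  rw [h, ← ENNReal.ofReal_add p.2.1 (by linarith [p.2.2])]
  simp

lemma tsum_preWt (W : Channel Y Z) {ρ : ℝ} (hρ : ρ ∈ Set.Ioo (0 : ℝ) 1) (pol : Policy Y) (n : ℕ) :
    ∑' h, preWt W ρ pol n h = ENNReal.ofReal (1 - ρ) ^ n := by
  induction n with
  | zero => simp [preWt_zero, tsum_fintype]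
  | succ n ih =>
    simp_rw [preWt_succ W hρ pol n]
    rw [tsum_hist_succ n fun h r => ENNReal.ofReal (1 - ρ) * preWt W ρ pol n h *
      stepWt W (pol.effSense n h) false r]
    simp_rw [ENNReal.tsum_mul_left, tsum_stepWt, mul_one]
    rw [ENNReal.tsum_mul_left, ih, pow_succ, mul_comm]

lemma ofReal_add_ofReal_one_sub {ρ : ℝ} (hρ : ρ ∈ Set.Ioo (0 : ℝ) 1) :
    ENNReal.ofReal ρ + ENNReal.ofReal (1 - ρ) = 1 := by
  rw [← ENNReal.ofReal_add hρ.1.le (by linarith [hρ.2])]; simp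

/-- The expected length of the pre-change period is `1 / ρ`. -/
lemma tsum_tsum_preWt (W : Channel Y Z) {ρ : ℝ} (hρ : ρ ∈ Set.Ioo (0 : ℝ) 1) (pol : Policy Y) :
    ∑' n, ∑' h, preWt W ρ pol n h = ENNReal.ofReal (1 / ρ) := by
  simp_rw [tsum_preWt W hρ, ENNReal.tsum_geometric]
  rw [one_div, ENNReal.ofReal_inv_of_pos hρ.1]
  congr 1
  rw [← ofReal_add_ofReal_one_sub hρ, ENNReal.add_sub_cancel_right ENNReal.ofReal_ne_top]

open scoped Classical in
/-- Up to time `n + 1` the policy has either stopped or is still running. -/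
lemma sum_stopAt_add_alive (W : Channel Y Z) {ρ : ℝ} (hρ : ρ ∈ Set.Ioo (0 : ℝ) 1) (pol : Policy Y)
    (n : ℕ) :
    ∑ m ∈ Finset.range n, (∑' h : Hist Y (m + 1), if pol.StopAt m h then
        postWt W ρ pol (m + 1) h + preWt W ρ pol (m + 1) h else 0) +
      ∑' h : Hist Y n, (if pol.Alive n h then postWt W ρ pol n h + preWt W ρ pol n h else 0) = 1 := by
  induction n with
  | zero =>
    simp [tsum_fintype, pol.alive_zero, preWt_zero, postWt_zero]
  | succ n ih =>
    rw [Finset.sum_range_succ, add_assoc, ← ENNReal.tsum_add, ← ih]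
    congr 1
    have h1 : ∀ h : Hist Y (n + 1), ((if pol.StopAt n h then
        postWt W ρ pol (n + 1) h + preWt W ρ pol (n + 1) h else 0) +
        (if pol.Alive (n + 1) h then
          postWt W ρ pol (n + 1) h + preWt W ρ pol (n + 1) h else 0)) =
        (fun (h : Hist Y n) r => if pol.Alive n h then
          postWt W ρ pol n h * stepWt W (pol.effSense n h) true r +
            preWt W ρ pol n h * stepWt W (pol.effSense n h) false r else 0)
          (Fin.init h) (h (Fin.last n)) := by
      intro h
      have h2 : postWt W ρ pol (n + 1) h + preWt W ρ pol (n + 1) h =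
          postWt W ρ pol n (Fin.init h) *
            stepWt W (pol.effSense n (Fin.init h)) true (h (Fin.last n)) +
          preWt W ρ pol n (Fin.init h) *
            stepWt W (pol.effSense n (Fin.init h)) false (h (Fin.last n)) := by
        rw [postWt_succ W hρ, preWt_succ W hρ, add_assoc, ← add_mul, ← add_mul,
          ofReal_add_ofReal_one_sub hρ, one_mul]
      rw [h2]
      have h3 := pol.alive_succ n h
      simp only [Policy.StopAt]
      by_cases ha : pol.Alive n (Fin.init h) <;> by_cases hb : pol.Alive (n + 1) h <;>
        simp_all
    simp_rw [h1]
    rw [tsum_hist_succ n fun (h : Hist Y n) r => if pol.Alive n h then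
          postWt W ρ pol n h * stepWt W (pol.effSense n h) true r +
            preWt W ρ pol n h * stepWt W (pol.effSense n h) false r else 0]
    refine tsum_congr fun h => ?_
    split_ifs
    · rw [ENNReal.tsum_add, ENNReal.tsum_mul_left, ENNReal.tsum_mul_left, tsum_stepWt,
        tsum_stepWt, mul_one, mul_one]
    · simp

/-! ### The posterior and the Shiryaev rule -/

section
variable [MeasurableSpace Y] [MeasurableSpace Z] [Countable Y] [Countable Z]
  [DiscreteMeasurableSpace Y] [DiscreteMeasurableSpace Z]

lemma law_hist_eq (W : Channel Y Z) {ρ : ℝ} (hρ : ρ ∈ Set.Ioo (0 : ℝ) 1) (pol : Policy Y)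
    (n : ℕ) (h : Hist Y n) :
    law W ρ pol {ω | hist n ω = h} = postWt W ρ pol n h + preWt W ρ pol n h := by
  classical
  have h1 := lintegral_law_ite W hρ pol n (fun h' => if h' = h then 1 else 0)
    (fun h' => if h' = h then 1 else 0)
  simp only [ite_self, mul_ite, mul_one, mul_zero] at h1
  rw [ENNReal.tsum_add, tsum_ite_eq, tsum_ite_eq] at h1
  have h2 : MeasurableSet {ω : ℕ × (ℕ → Bool × Y × Z) | hist n ω = h} :=
    measurable_hist n (MeasurableSet.of_discrete (s := {h}))
  rw [← h1, ← lintegral_indicator_one h2]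
  exact lintegral_congr fun ω => by simp [Set.indicator_apply]

/-- An almost sure property holds somewhere on every history of positive probability. -/
lemma exists_of_ae_law (W : Channel Y Z) {ρ : ℝ} (hρ : ρ ∈ Set.Ioo (0 : ℝ) 1) (pol : Policy Y)
    {p : ℕ × (ℕ → Bool × Y × Z) → Prop} (hp : ∀ᵐ ω ∂(law W ρ pol), p ω) {n : ℕ} {h : Hist Y n}
    (hh : preWt W ρ pol n h ≠ 0) : ∃ ω, hist n ω = h ∧ p ω := by
  by_contra hcon
  push Not at hcon
  have h1 : law W ρ pol {ω | hist n ω = h} = 0 :=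
    measure_mono_null (fun ω hω => hcon ω hω) (ae_iff.1 hp)
  rw [law_hist_eq W hρ] at h1
  exact hh (add_eq_zero.1 h1).2

/-- The posterior probability of a past change, in terms of the posterior odds. -/
lemma posterior_eq (W : Channel Y Z) {ρ : ℝ} (hρ : ρ ∈ Set.Ioo (0 : ℝ) 1)
    (hP : aliceChannel W false true = aliceChannel W false false)
    (hac : AbsCont (aliceChannel W true true) (aliceChannel W true false)) (pol : Policy Y)
    (n : ℕ) :
    posterior W ρ pol n =ᵐ[law W ρ pol]
      fun ω => odds W ρ n (hist n ω) / (1 + odds W ρ n (hist n ω)) := by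
  have := isProbabilityMeasure_law W hρ pol
  -- both sides have the same integral over every event of `info n`
  have hm : (info n : MeasurableSpace (ℕ × (ℕ → Bool × Y × Z))) ≤
      Prod.instMeasurableSpace :=
    (measurable_hist n).comap_le
  set g : ℕ × (ℕ → Bool × Y × Z) → ℝ :=
    fun ω => odds W ρ n (hist n ω) / (1 + odds W ρ n (hist n ω)) with hg
  have hgm : Measurable[info n] g :=
    (Measurable.of_discrete (f := fun h => odds W ρ n h / (1 + odds W ρ n h))).comp
      (comap_measurable (hist n))
  have hgm' : Measurable g := hgm.mono hm le_rfl
  have hg0 : ∀ ω, 0 ≤ g ω := fun ω => by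
    have := odds_nonneg W hρ n (hist n ω)
    simp only [hg]; positivity
  have hg1 : ∀ ω, g ω ≤ 1 := fun ω => by
    have := odds_nonneg W hρ n (hist n ω)
    simp only [hg]; rw [div_le_one (by positivity)]; linarith
  have hgi : Integrable g (law W ρ pol) :=
    Integrable.of_bound hgm'.aestronglyMeasurable 1 (Filter.Eventually.of_forall fun ω => by
      rw [Real.norm_of_nonneg (hg0 ω)]; exact hg1 ω)
  have hA : MeasurableSet {ω : ℕ × (ℕ → Bool × Y × Z) | ω.1 < n + 1} :=
    measurable_fst (MeasurableSet.of_discrete (s := {k : ℕ | k < n + 1}))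
  symm
  refine ae_eq_condExp_of_forall_setIntegral_eq hm
    ((integrable_const (1 : ℝ)).indicator hA) (fun s _ _ => hgi.integrableOn) ?_
    hgm.stronglyMeasurable.aestronglyMeasurable
  rintro s ⟨S, hS, rfl⟩ -
  have hSm : MeasurableSet (hist n ⁻¹' S : Set (ℕ × (ℕ → Bool × Y × Z))) :=
    measurable_hist n MeasurableSet.of_discrete
  classical
  rw [integral_eq_lintegral_of_nonneg_ae (Filter.Eventually.of_forall hg0)
      hgm'.aestronglyMeasurable,
    integral_eq_lintegral_of_nonneg_ae (Filter.Eventually.of_forall fun ω =>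
      Set.indicator_nonneg (fun _ _ => zero_le_one) _)
      ((measurable_const.indicator hA).aestronglyMeasurable)]
  congr 1
  rw [← lintegral_indicator hSm, ← lintegral_indicator hSm]
  have e1 : ∀ ω : ℕ × (ℕ → Bool × Y × Z),
      (hist n ⁻¹' S).indicator (fun ω => ENNReal.ofReal (g ω)) ω =
      if ω.1 ≤ n then (S.indicator (fun h => ENNReal.ofReal
          (odds W ρ n h / (1 + odds W ρ n h)))) (hist n ω)
        else (S.indicator (fun h => ENNReal.ofReal
          (odds W ρ n h / (1 + odds W ρ n h)))) (hist n ω) := by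
    intro ω
    rw [ite_self]; rfl
  have e2 : ∀ ω : ℕ × (ℕ → Bool × Y × Z),
      (hist n ⁻¹' S).indicator (fun ω => ENNReal.ofReal
        ({ω : ℕ × (ℕ → Bool × Y × Z) | ω.1 < n + 1}.indicator (fun _ => (1 : ℝ)) ω)) ω =
      if ω.1 ≤ n then (S.indicator (fun _ => 1)) (hist n ω)
        else (fun _ => 0) (hist n ω) := by
    intro ω
    simp only [Set.indicator_apply, Set.mem_preimage, Set.mem_ofPred_eq, Nat.lt_succ_iff]
    split_ifs <;> simp
  rw [lintegral_congr e1, lintegral_congr e2, lintegral_law_ite W hρ,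
    lintegral_law_ite W hρ pol n (S.indicator fun _ => 1) fun _ => 0]
  refine tsum_congr fun h => ?_
  by_cases hh : h ∈ S
  · simp only [Set.indicator_of_mem hh]
    have h0 := odds_nonneg W hρ n h
    have h1 : (ENNReal.ofReal (odds W ρ n h) + 1) *
        ENNReal.ofReal (odds W ρ n h / (1 + odds W ρ n h)) = ENNReal.ofReal (odds W ρ n h) := by
      rw [← ENNReal.ofReal_one, ← ENNReal.ofReal_add h0 zero_le_one,
        ← ENNReal.ofReal_mul (by positivity)]
      congr 1
      field_simp
      ring
    rw [postWt_eq W hρ hP hac, mul_one, mul_zero, add_zero]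
    nth_rw 2 [← h1]
    ring
  · simp [hh]

/-- The Shiryaev stopping rule in terms of the posterior odds. -/
lemma one_sub_le_posterior_iff {α R : ℝ} (hR : 0 ≤ R) :
    1 - α ≤ R / (1 + R) ↔ 1 - α ≤ α * R := by
  rw [le_div_iff₀ (by positivity)]
  constructor <;> intro h <;> nlinarith

/-- Almost surely, a Shiryaev policy is active exactly until the odds reach `(1 - α) / α`. -/
lemma IsShiryaev.ae_alive_iff {W : Channel Y Z} {ρ α β : ℝ} {pol : Policy Y}
    (hS : IsShiryaev W ρ α β pol) (hρ : ρ ∈ Set.Ioo (0 : ℝ) 1)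
    (hP : aliceChannel W false true = aliceChannel W false false)
    (hac : AbsCont (aliceChannel W true true) (aliceChannel W true false)) :
    ∀ᵐ ω ∂(law W ρ pol), ∀ n : ℕ, pol.Alive n (hist n ω) ↔
      ∀ m ≤ n, α * odds W ρ m (hist m ω) < 1 - α := by
  have h1 : ∀ᵐ ω ∂(law W ρ pol), ∀ n, posterior W ρ pol n ω =
      odds W ρ n (hist n ω) / (1 + odds W ρ n (hist n ω)) :=
    ae_all_iff.2 fun n => posterior_eq W hρ hP hac pol n
  filter_upwards [hS.2, h1] with ω h2 h3 n
  rw [← pol.lt_stopTime_iff, h2, lt_sInf_time_iff (fun n => 1 - α ≤ posterior W ρ pol n ω)]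
  refine forall₂_congr fun m _ => ?_
  rw [h3, one_sub_le_posterior_iff (odds_nonneg W hρ _ _), not_le]

lemma IsShiryaev.odds_lt_of_alive {W : Channel Y Z} {ρ α β : ℝ} {pol : Policy Y}
    (hS : IsShiryaev W ρ α β pol) (hρ : ρ ∈ Set.Ioo (0 : ℝ) 1)
    (hP : aliceChannel W false true = aliceChannel W false false)
    (hac : AbsCont (aliceChannel W true true) (aliceChannel W true false))
    {n : ℕ} {h : Hist Y n} (hh : preWt W ρ pol n h ≠ 0) (ha : pol.Alive n h) :
    α * odds W ρ n h < 1 - α := by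
  obtain ⟨ω, rfl, hω⟩ := exists_of_ae_law W hρ pol (hS.ae_alive_iff hρ hP hac) hh
  exact (hω n).1 ha n le_rfl

lemma IsShiryaev.le_odds_of_stopAt {W : Channel Y Z} {ρ α β : ℝ} {pol : Policy Y}
    (hS : IsShiryaev W ρ α β pol) (hρ : ρ ∈ Set.Ioo (0 : ℝ) 1)
    (hP : aliceChannel W false true = aliceChannel W false false)
    (hac : AbsCont (aliceChannel W true true) (aliceChannel W true false))
    {n : ℕ} {h : Hist Y (n + 1)} (hh : preWt W ρ pol (n + 1) h ≠ 0) (ha : pol.StopAt n h) :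
    1 - α ≤ α * odds W ρ (n + 1) h := by
  obtain ⟨ω, rfl, hω⟩ := exists_of_ae_law W hρ pol (hS.ae_alive_iff hρ hP hac) hh
  have h1 : pol.Alive n (hist n ω) := ha.1
  by_contra hcon
  refine ha.2 ((hω (n + 1)).2 fun m hm => ?_)
  rcases Nat.lt_or_ge m (n + 1) with h' | h'
  · exact (hω n).1 h1 m (by omega)
  · obtain rfl : m = n + 1 := by omega
    exact not_le.1 hcon

lemma exists_isShiryaev (W : Channel Y Z) {ρ : ℝ} (hρ : ρ ∈ Set.Ioo (0 : ℝ) 1)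
    (hP : aliceChannel W false true = aliceChannel W false false)
    (hac : AbsCont (aliceChannel W true true) (aliceChannel W true false))
    {α β : ℝ} (hα : α < 1) (hβ : β ∈ Set.Icc (0 : ℝ) 1) :
    ∃ pol : Policy Y, IsShiryaev W ρ α β pol := by
  classical
  refine ⟨⟨fun _ _ => ⟨β, hβ⟩, fun n h => decide (1 - α ≤ α * odds W ρ n h), fun h => ?_⟩,
    fun _ _ => rfl, ?_⟩
  · simp [odds, hα]
  · have h1 := fun pol : Policy Y => ae_all_iff.2 fun n => posterior_eq W hρ hP hac pol n
    filter_upwards [h1 _] with ω hω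
    rw [Policy.stopTime]
    congr 1
    ext t
    simp only [Set.mem_ofPred_eq, decide_eq_true_eq]
    refine exists_congr fun n => and_congr_right fun _ => ?_
    rw [hω, one_sub_le_posterior_iff (odds_nonneg W hρ _ _)]

/-- The Shiryaev rule keeps the false-alarm probability below its level. -/
lemma IsShiryaev.PFA_le {W : Channel Y Z} {ρ α β : ℝ} {pol : Policy Y}
    (hS : IsShiryaev W ρ α β pol) (hρ : ρ ∈ Set.Ioo (0 : ℝ) 1)
    (hP : aliceChannel W false true = aliceChannel W false false)
    (hac : AbsCont (aliceChannel W true true) (aliceChannel W true false)) (hα : 0 < α) :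
    PFA W ρ pol ≤ ENNReal.ofReal α := by
  classical
  -- where the rule stops, `ℙ(Γ > n + 1 | h) = 1 / (1 + odds) ≤ α`
  have h1 : ∀ n, ∀ h : Hist Y (n + 1), (if pol.StopAt n h then
      ENNReal.ofReal (1 - ρ) * preWt W ρ pol (n + 1) h else 0) ≤
      ENNReal.ofReal α * (if pol.StopAt n h then
        postWt W ρ pol (n + 1) h + preWt W ρ pol (n + 1) h else 0) := by
    intro n h
    split_ifs with hs
    · by_cases hh : preWt W ρ pol (n + 1) h = 0
      · simp [hh]
      · have h2 := hS.le_odds_of_stopAt hρ hP hac hh hs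
        have h0 := odds_nonneg W hρ (n + 1) h
        rw [postWt_eq W hρ hP hac, ← add_one_mul, ← ENNReal.ofReal_one,
          ← ENNReal.ofReal_add h0 zero_le_one, ← mul_assoc, ← ENNReal.ofReal_mul hα.le]
        gcongr
        linarith [hρ.1]
    · simp
  rw [PFA_eq W hρ]
  calc _ ≤ ∑' n, ∑' h : Hist Y (n + 1), ENNReal.ofReal α * (if pol.StopAt n h then
        postWt W ρ pol (n + 1) h + preWt W ρ pol (n + 1) h else 0) :=
        ENNReal.tsum_le_tsum fun n => ENNReal.tsum_le_tsum fun h => h1 n h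
    _ ≤ ENNReal.ofReal α * 1 := by
        simp_rw [ENNReal.tsum_mul_left]
        gcongr
        refine ENNReal.tsum_le_of_sum_range_le fun n => ?_
        rw [← sum_stopAt_add_alive W hρ pol n]
        exact le_self_add
    _ = _ := mul_one _

end

/-! ### The converse: growth of `log (1 + odds)` -/

lemma priorExp_eq {ρ : ℝ} (hρ : ρ ∈ Set.Ioo (0 : ℝ) 1) : priorExp ρ = -Real.log (1 - ρ) := by
  rw [priorExp, abs_of_neg (Real.log_neg (by linarith [hρ.2]) (by linarith [hρ.1]))]

lemma priorExp_pos {ρ : ℝ} (hρ : ρ ∈ Set.Ioo (0 : ℝ) 1) : 0 < priorExp ρ := by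
  rw [priorExp_eq hρ]
  linarith [Real.log_neg (by linarith [hρ.2] : 0 < 1 - ρ) (by linarith [hρ.1])]

/-- Convexity of `x log x`, as an upper bound for the growth of `log (1 + R)` when the odds `R`
are multiplied by the likelihood ratio `t`. -/
lemma one_add_mul_log_le {R t : ℝ} (hR : 0 ≤ R) (ht : 0 ≤ t) :
    (1 + R * t) * Real.log (1 + R * t) + R ≤
      (1 + R * t) * Real.log (1 + R) + R * klFun t + R * t := by
  have h1 : (0 : ℝ) < 1 + R := by positivity
  have h2 : (0 : ℝ) < 1 + R * t := by positivity
  have ha : 0 ≤ 1 / (1 + R) := by positivity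
  have hb : 0 ≤ R / (1 + R) := by positivity
  have hab : 1 / (1 + R) + R / (1 + R) = 1 := by field_simp
  have h := Real.convexOn_mul_log.2 (Set.mem_Ici.2 zero_le_one) (Set.mem_Ici.2 ht) ha hb hab
  simp only [smul_eq_mul, Real.log_one, mul_zero, zero_add, mul_one] at h
  have h3 : 1 / (1 + R) + R / (1 + R) * t = (1 + R * t) / (1 + R) := by field_simp
  rw [h3, Real.log_div h2.ne' h1.ne'] at h
  have h4 : (1 + R * t) * (Real.log (1 + R * t) - Real.log (1 + R)) ≤ R * (t * Real.log t) := by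
    have := mul_le_mul_of_nonneg_left h h1.le
    have e1 : (1 + R) * ((1 + R * t) / (1 + R) * (Real.log (1 + R * t) - Real.log (1 + R))) =
      (1 + R * t) * (Real.log (1 + R * t) - Real.log (1 + R)) := by field_simp
    have e2 : (1 + R) * (R / (1 + R) * (t * Real.log t)) = R * (t * Real.log t) := by field_simp
    linarith
  rw [klFun]
  linarith

section KL
variable [MeasurableSpace Y] [Countable Y] [DiscreteMeasurableSpace Y]

lemma lintegral_PMF (P : PMF Y) (g : Y → ℝ≥0∞) :
    ∫⁻ y, g y ∂P.toMeasure = ∑' y, P y * g y := by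
  rw [lintegral_countable']
  refine tsum_congr fun y => ?_
  rw [PMF.toMeasure_apply_singleton _ _ (measurableSet_singleton y), mul_comm]

lemma absCont_of_toMeasure {P Q : PMF Y} (h : P.toMeasure ≪ Q.toMeasure) : AbsCont P Q := by
  intro a ha
  have h1 := PMF.toMeasure_apply_singleton P a (measurableSet_singleton a)
  have h2 := PMF.toMeasure_apply_singleton Q a (measurableSet_singleton a)
  rw [← h1]
  exact h (by rw [h2, ha])

lemma toMeasure_eq_withDensity {P Q : PMF Y} (h : AbsCont P Q) :
    P.toMeasure = Q.toMeasure.withDensity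
      (fun y => ENNReal.ofReal ((P y).toReal / (Q y).toReal)) := by
  refine Measure.ext_of_singleton fun y => ?_
  rw [withDensity_apply _ (measurableSet_singleton y), lintegral_singleton,
    PMF.toMeasure_apply_singleton _ _ (measurableSet_singleton y),
    PMF.toMeasure_apply_singleton _ _ (measurableSet_singleton y), ofReal_toReal_div_mul h]

lemma rnDeriv_PMF {P Q : PMF Y} (h : AbsCont P Q) :
    P.toMeasure.rnDeriv Q.toMeasure =ᵐ[Q.toMeasure]
      fun y => ENNReal.ofReal ((P y).toReal / (Q y).toReal) := by
  rw [toMeasure_eq_withDensity h]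
  exact Measure.rnDeriv_withDensity _ Measurable.of_discrete

lemma klDiv_PMF {P Q : PMF Y} (hac : P.toMeasure ≪ Q.toMeasure) :
    klDiv P.toMeasure Q.toMeasure =
      ∑' y, Q y * ENNReal.ofReal (klFun ((P y).toReal / (Q y).toReal)) := by
  rw [klDiv_eq_lintegral_klFun_of_ac hac, ← lintegral_PMF]
  refine lintegral_congr_ae ?_
  filter_upwards [rnDeriv_PMF (absCont_of_toMeasure hac)] with y hy
  rw [hy, ENNReal.toReal_ofReal (by positivity)]

end KL

section
variable [MeasurableSpace Y] [MeasurableSpace Z] [Countable Y] [Countable Z]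
  [DiscreteMeasurableSpace Y] [DiscreteMeasurableSpace Z]

lemma absolutelyContinuous_of_gainD {W : Channel Y Z} (hD : gainD W < ∞) :
    (aliceChannel W true true).toMeasure ≪ (aliceChannel W true false).toMeasure :=
  (klDiv_ne_top_iff.1 hD.ne).1

/-- The information gain of a round is `p D`. -/
lemma tsum_stepWt_klFun {W : Channel Y Z} (hD : gainD W < ∞) (p : unitInterval) :
    ∑' r, stepWt W p false r * ENNReal.ofReal (klFun (roundRatio W r)) =
      ENNReal.ofReal p * gainD W := by
  rw [tsum_stepWt_mul, gainD, klDiv_PMF (absolutelyContinuous_of_gainD hD)]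
  simp [roundRatio, probeRatio, klFun_one]

/-- One-step bound for the growth of `log (1 + odds)`. -/
lemma tsum_stepWt_log_le {W : Channel Y Z}
    (hP : aliceChannel W false true = aliceChannel W false false)
    (hD : gainD W < ∞) (p : unitInterval) {R d : ℝ} (hR : 0 ≤ R) (hd : 0 ≤ d) :
    ∑' r, stepWt W p false r * ENNReal.ofReal
        ((1 + R * roundRatio W r) * (d + Real.log (1 + R * roundRatio W r))) ≤
      ENNReal.ofReal (1 + R) * ENNReal.ofReal (d + Real.log (1 + R)) +
        ENNReal.ofReal R * (ENNReal.ofReal p * gainD W) := by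
  have hac := absCont_of_toMeasure (absolutelyContinuous_of_gainD hD)
  have hG : 0 ≤ Real.log (1 + R) := Real.log_nonneg (by linarith)
  -- the summand `R` on both sides keeps every term nonnegative; it is cancelled at the end
  have h1 : ∀ r, stepWt W p false r * ENNReal.ofReal
        ((1 + R * roundRatio W r) * (d + Real.log (1 + R * roundRatio W r))) +
        stepWt W p false r * ENNReal.ofReal R ≤
      (stepWt W p false r + ENNReal.ofReal R * (ENNReal.ofReal (roundRatio W r) *
        stepWt W p false r)) * ENNReal.ofReal (d + Real.log (1 + R)) +
      ENNReal.ofReal R * (stepWt W p false r * ENNReal.ofReal (klFun (roundRatio W r))) +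
      ENNReal.ofReal R * (ENNReal.ofReal (roundRatio W r) * stepWt W p false r) := by
    intro r
    have ht := roundRatio_nonneg W r
    have hk := klFun_nonneg ht
    have hRt : 0 ≤ R * roundRatio W r := by positivity
    have hl : 0 ≤ Real.log (1 + R * roundRatio W r) := Real.log_nonneg (by linarith)
    have h2 := one_add_mul_log_le hR ht
    rw [← mul_add, ← ENNReal.ofReal_add (by positivity) hR]
    calc _ ≤ stepWt W p false r * ENNReal.ofReal
          ((1 + R * roundRatio W r) * (d + Real.log (1 + R)) + R * klFun (roundRatio W r) +
            R * roundRatio W r) := by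
          refine mul_le_mul_right (ENNReal.ofReal_le_ofReal ?_) _
          linarith
      _ = _ := by
          rw [ENNReal.ofReal_add (by positivity) hRt, ENNReal.ofReal_add (by positivity)
            (by positivity), ENNReal.ofReal_mul (by positivity), ENNReal.ofReal_add zero_le_one hRt,
            ENNReal.ofReal_mul hR, ENNReal.ofReal_mul hR, ENNReal.ofReal_one]
          ring
  have h3 := ENNReal.tsum_le_tsum h1
  simp_rw [ENNReal.tsum_add, ENNReal.tsum_mul_right] at h3
  simp_rw [ENNReal.tsum_add, ENNReal.tsum_mul_left, ← stepWt_true W hP hac, tsum_stepWt,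
    tsum_stepWt_klFun hD] at h3
  rw [mul_one, one_mul] at h3
  rw [ENNReal.ofReal_add zero_le_one hR, ENNReal.ofReal_one]
  exact (ENNReal.add_le_add_iff_right ENNReal.ofReal_ne_top).1 h3

lemma log_one_add_odds_succ (W : Channel Y Z) {ρ : ℝ} (hρ : ρ ∈ Set.Ioo (0 : ℝ) 1) (n : ℕ)
    (h : Hist Y (n + 1)) :
    Real.log (1 + odds W ρ (n + 1) h) = priorExp ρ +
      Real.log (1 + odds W ρ n (Fin.init h) * roundRatio W (h (Fin.last n))) := by
  have h1 : 0 < 1 - ρ := by linarith [hρ.2]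
  have h2 := odds_nonneg W hρ n (Fin.init h)
  have h3 := roundRatio_nonneg W (h (Fin.last n))
  have h4 : 1 + odds W ρ (n + 1) h =
      (1 + odds W ρ n (Fin.init h) * roundRatio W (h (Fin.last n))) / (1 - ρ) := by
    rw [odds]; field_simp; ring
  rw [h4, Real.log_div (by positivity) h1.ne', priorExp_eq hρ]
  ring

open scoped Classical in
/-- Among the runs still active at time `n + 1`, the expected growth of `log (1 + odds)` in one
round is at most `d` plus the information gain of the round. -/
lemma alive_add_stopAt_log_le {W : Channel Y Z} {ρ : ℝ} (hρ : ρ ∈ Set.Ioo (0 : ℝ) 1)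
    (hP : aliceChannel W false true = aliceChannel W false false)
    (hD : gainD W < ∞) (pol : Policy Y) (n : ℕ) :
    (∑' h : Hist Y (n + 1), if pol.Alive (n + 1) h then
        (postWt W ρ pol (n + 1) h + preWt W ρ pol (n + 1) h) *
          ENNReal.ofReal (Real.log (1 + odds W ρ (n + 1) h)) else 0) +
      (∑' h : Hist Y (n + 1), if pol.StopAt n h then
        (postWt W ρ pol (n + 1) h + preWt W ρ pol (n + 1) h) *
          ENNReal.ofReal (Real.log (1 + odds W ρ (n + 1) h)) else 0) ≤
    (∑' h : Hist Y n, if pol.Alive n h then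
        (postWt W ρ pol n h + preWt W ρ pol n h) *
          ENNReal.ofReal (Real.log (1 + odds W ρ n h)) else 0) +
      ∑' h : Hist Y n, if pol.Alive n h then
        (postWt W ρ pol n h + preWt W ρ pol n h) * ENNReal.ofReal (priorExp ρ) +
          postWt W ρ pol n h * (ENNReal.ofReal (pol.effSense n h) * gainD W) else 0 := by
  have hac := absCont_of_toMeasure (absolutelyContinuous_of_gainD hD)
  have hd := (priorExp_pos hρ).le
  rw [← ENNReal.tsum_add, ← ENNReal.tsum_add]
  have h1 : ∀ h : Hist Y (n + 1), ((if pol.Alive (n + 1) h then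
        (postWt W ρ pol (n + 1) h + preWt W ρ pol (n + 1) h) *
          ENNReal.ofReal (Real.log (1 + odds W ρ (n + 1) h)) else 0) +
      (if pol.StopAt n h then
        (postWt W ρ pol (n + 1) h + preWt W ρ pol (n + 1) h) *
          ENNReal.ofReal (Real.log (1 + odds W ρ (n + 1) h)) else 0)) =
      (fun (h : Hist Y n) r => if pol.Alive n h then preWt W ρ pol n h *
        (stepWt W (pol.effSense n h) false r * ENNReal.ofReal
        ((1 + odds W ρ n h * roundRatio W r) *
          (priorExp ρ + Real.log (1 + odds W ρ n h * roundRatio W r)))) else 0)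
        (Fin.init h) (h (Fin.last n)) := by
    intro h
    have hR := odds_nonneg W hρ n (Fin.init h)
    have ht := roundRatio_nonneg W (h (Fin.last n))
    have h2 : postWt W ρ pol (n + 1) h + preWt W ρ pol (n + 1) h =
        preWt W ρ pol n (Fin.init h) *
        (stepWt W (pol.effSense n (Fin.init h)) false (h (Fin.last n)) *
          ENNReal.ofReal (1 + odds W ρ n (Fin.init h) * roundRatio W (h (Fin.last n)))) := by
      rw [postWt_succ W hρ, preWt_succ W hρ, add_assoc, ← add_mul, ← add_mul,
          ofReal_add_ofReal_one_sub hρ, one_mul, stepWt_true W hP hac, postWt_eq W hρ hP hac,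
          ENNReal.ofReal_add zero_le_one (by positivity), ENNReal.ofReal_mul hR,
          ENNReal.ofReal_one]
      ring
    simp only [h2, log_one_add_odds_succ W hρ,
      ENNReal.ofReal_mul (by positivity :
        0 ≤ 1 + odds W ρ n (Fin.init h) * roundRatio W (h (Fin.last n)))]
    have h3 := pol.alive_succ n h
    simp only [Policy.StopAt]
    by_cases ha : pol.Alive n (Fin.init h) <;> by_cases hb : pol.Alive (n + 1) h <;>
        simp_all [mul_assoc]
  rw [tsum_congr h1, tsum_hist_succ n (fun (h : Hist Y n) r => if pol.Alive n h then
      preWt W ρ pol n h *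
        (stepWt W (pol.effSense n h) false r * ENNReal.ofReal
        ((1 + odds W ρ n h * roundRatio W r) *
          (priorExp ρ + Real.log (1 + odds W ρ n h * roundRatio W r)))) else 0)]
  refine ENNReal.tsum_le_tsum fun h => ?_
  by_cases ha : pol.Alive n h
  · simp only [if_pos ha]
    have hR := odds_nonneg W hρ n h
    have hG : 0 ≤ Real.log (1 + odds W ρ n h) := Real.log_nonneg (by linarith)
    rw [ENNReal.tsum_mul_left]
    refine (mul_le_mul_right (tsum_stepWt_log_le hP hD (pol.effSense n h) hR hd) _).trans ?_
    rw [postWt_eq W hρ hP hac, ENNReal.ofReal_add hd hG, ENNReal.ofReal_add zero_le_one hR,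
      ENNReal.ofReal_one]
    apply le_of_eq
    ring
  · simp [ha]

open scoped Classical in
/-- The expected value of `log (1 + odds)` at the stopping time is at most `d` times the expected
number of rounds plus the total information gain. -/
lemma tsum_stopAt_log_le {W : Channel Y Z} {ρ : ℝ} (hρ : ρ ∈ Set.Ioo (0 : ℝ) 1)
    (hP : aliceChannel W false true = aliceChannel W false false)
    (hD : gainD W < ∞) (pol : Policy Y) :
    (∑' n, ∑' h : Hist Y (n + 1), if pol.StopAt n h then
        (postWt W ρ pol (n + 1) h + preWt W ρ pol (n + 1) h) *
          ENNReal.ofReal (Real.log (1 + odds W ρ (n + 1) h)) else 0) ≤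
    ∑' n, ∑' h : Hist Y n, if pol.Alive n h then
        (postWt W ρ pol n h + preWt W ρ pol n h) * ENNReal.ofReal (priorExp ρ) +
          postWt W ρ pol n h * (ENNReal.ofReal (pol.effSense n h) * gainD W) else 0 := by
  have key : ∀ n, (∑' h : Hist Y n, if pol.Alive n h then
        (postWt W ρ pol n h + preWt W ρ pol n h) *
          ENNReal.ofReal (Real.log (1 + odds W ρ n h)) else 0) +
      (∑ m ∈ Finset.range n, ∑' h : Hist Y (m + 1), if pol.StopAt m h then
        (postWt W ρ pol (m + 1) h + preWt W ρ pol (m + 1) h) *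
          ENNReal.ofReal (Real.log (1 + odds W ρ (m + 1) h)) else 0) ≤
      ∑ m ∈ Finset.range n, ∑' h : Hist Y m, if pol.Alive m h then
        (postWt W ρ pol m h + preWt W ρ pol m h) * ENNReal.ofReal (priorExp ρ) +
          postWt W ρ pol m h * (ENNReal.ofReal (pol.effSense m h) * gainD W) else 0 := by
    intro n
    induction n with
    | zero => simp [odds]
    | succ n ih =>
      rw [Finset.sum_range_succ, Finset.sum_range_succ, add_comm (Finset.sum _ _), ← add_assoc]
      refine (add_le_add_left (alive_add_stopAt_log_le hρ hP hD pol n) _).trans ?_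
      rw [add_right_comm]
      exact add_le_add_left ih _
  refine ENNReal.tsum_le_of_sum_range_le fun n => ?_
  exact (le_add_self.trans (key n)).trans (ENNReal.sum_le_tsum _)

open scoped Classical in
/-- A policy with finite expected delay stops almost surely. -/
lemma tsum_stopAt_eq_one {W : Channel Y Z} {ρ : ℝ} (hρ : ρ ∈ Set.Ioo (0 : ℝ) 1) (pol : Policy Y)
    (hA : ADD W ρ pol < ∞) :
    (∑' n, ∑' h : Hist Y (n + 1), if pol.StopAt n h then
        postWt W ρ pol (n + 1) h + preWt W ρ pol (n + 1) h else 0) = 1 := by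
  have h1 : (∑' n, ∑' h : Hist Y n,
      if pol.Alive n h then postWt W ρ pol n h + preWt W ρ pol n h else 0) ≠ ∞ := by
    have h2 : (∑' n, ∑' h : Hist Y n,
        if pol.Alive n h then postWt W ρ pol n h + preWt W ρ pol n h else 0) ≤
        ADD W ρ pol + ENNReal.ofReal (1 / ρ) := by
      rw [ADD_eq W hρ, ← tsum_tsum_preWt W hρ pol, ← ENNReal.tsum_add]
      refine ENNReal.tsum_le_tsum fun n => ?_
      rw [← ENNReal.tsum_add]
      refine ENNReal.tsum_le_tsum fun h => ?_
      split_ifs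
      · gcongr
        exact le_self_add
      · simp
    exact ne_top_of_le_ne_top (ENNReal.add_ne_top.2 ⟨hA.ne, ENNReal.ofReal_ne_top⟩) h2
  have h3 := (ENNReal.summable (f := fun n => ∑' h : Hist Y (n + 1), if pol.StopAt n h then
        postWt W ρ pol (n + 1) h + preWt W ρ pol (n + 1) h else 0)).hasSum.tendsto_sum_nat.add
    (ENNReal.tendsto_atTop_zero_of_tsum_ne_top h1)
  simp only [sum_stopAt_add_alive W hρ pol, add_zero] at h3
  exact tendsto_nhds_unique h3 tendsto_const_nhds

/-- A small false-alarm probability forces a large expected value of `log (1 + odds)` at the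
stopping time. -/
lemma le_tsum_stopAt_log {W : Channel Y Z} {ρ : ℝ} (hρ : ρ ∈ Set.Ioo (0 : ℝ) 1)
    (hP : aliceChannel W false true = aliceChannel W false false)
    (hD : gainD W < ∞) (pol : Policy Y) {α : ℝ} (hα : 0 < α)
    (hA : ADD W ρ pol < ∞) (hF : PFA W ρ pol ≤ ENNReal.ofReal α) :
    ENNReal.ofReal (1 - Real.log (α / (1 - ρ))) ≤
    ENNReal.ofReal (priorExp ρ) * (ADD W ρ pol + ENNReal.ofReal ((1 - ρ) / ρ)) +
      (∑' n, ∑' h : Hist Y n, postWt W ρ pol n h * ENNReal.ofReal (pol.effSense n h)) * gainD W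
      + 1 := by
  classical
  have hac := absCont_of_toMeasure (absolutelyContinuous_of_gainD hD)
  have h1ρ : 0 < 1 - ρ := by linarith [hρ.2]
  set a := α / (1 - ρ) with ha
  have ha0 : 0 < a := by positivity
  have h_one := tsum_stopAt_eq_one hρ pol hA
  -- Jensen's inequality in the form `1 - ln a ≤ ln x + (1 / a) / x`, with `x = 1 + odds`
  have h1 : ∀ n, ∀ h : Hist Y (n + 1), ENNReal.ofReal (1 - Real.log a) * (if pol.StopAt n h then
        postWt W ρ pol (n + 1) h + preWt W ρ pol (n + 1) h else 0) ≤
      (if pol.StopAt n h then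
        (postWt W ρ pol (n + 1) h + preWt W ρ pol (n + 1) h) *
          ENNReal.ofReal (Real.log (1 + odds W ρ (n + 1) h)) else 0) +
      ENNReal.ofReal (1 / α) * (if pol.StopAt n h then
        ENNReal.ofReal (1 - ρ) * preWt W ρ pol (n + 1) h else 0) := by
    intro n h
    split_ifs
    · have hR := odds_nonneg W hρ (n + 1) h
      set R := odds W ρ (n + 1) h
      have h2 : postWt W ρ pol (n + 1) h + preWt W ρ pol (n + 1) h =
          ENNReal.ofReal (1 + R) * preWt W ρ pol (n + 1) h := by
        rw [postWt_eq W hρ hP hac, ENNReal.ofReal_add zero_le_one hR, ENNReal.ofReal_one]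
        ring
      have hl : 0 ≤ Real.log (1 + R) := Real.log_nonneg (by linarith)
      have h4 : ENNReal.ofReal (1 / α) * (ENNReal.ofReal (1 - ρ) * preWt W ρ pol (n + 1) h) =
          ENNReal.ofReal (1 / a) * preWt W ρ pol (n + 1) h := by
        rw [← mul_assoc, ← ENNReal.ofReal_mul (by positivity)]
        congr 2
        rw [ha]; field_simp
      rw [h2, h4, mul_right_comm, ← ENNReal.ofReal_mul (by positivity), ← add_mul,
        ← ENNReal.ofReal_add (by positivity) (by positivity), ← mul_assoc]
      gcongr ?_ * _
      rw [← ENNReal.ofReal_mul' (by positivity)]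
      apply ENNReal.ofReal_le_ofReal
      have h5 := Real.log_le_sub_one_of_pos (x := 1 / (a * (1 + R))) (by positivity)
      rw [one_div, Real.log_inv, Real.log_mul ha0.ne' (by positivity)] at h5
      have h6 : 1 / a = (a * (1 + R))⁻¹ * (1 + R) := by field_simp
      rw [h6]
      nlinarith
    · simp
  have h2 : ENNReal.ofReal (1 - Real.log a) ≤
      (∑' n, ∑' h : Hist Y (n + 1), if pol.StopAt n h then
        (postWt W ρ pol (n + 1) h + preWt W ρ pol (n + 1) h) *
          ENNReal.ofReal (Real.log (1 + odds W ρ (n + 1) h)) else 0) +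
      ENNReal.ofReal (1 / α) * PFA W ρ pol := by
    rw [PFA_eq W hρ, ← ENNReal.tsum_mul_left, ← ENNReal.tsum_add]
    nth_rw 1 [← mul_one (ENNReal.ofReal _)]
    rw [← h_one, ← ENNReal.tsum_mul_left]
    refine ENNReal.tsum_le_tsum fun n => ?_
    rw [← ENNReal.tsum_mul_left, ← ENNReal.tsum_mul_left, ← ENNReal.tsum_add]
    exact ENNReal.tsum_le_tsum fun h => h1 n h
  have h3 : ENNReal.ofReal (1 / α) * PFA W ρ pol ≤ 1 := by
    refine (mul_le_mul_right hF _).trans ?_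
    rw [← ENNReal.ofReal_mul (by positivity), one_div_mul_cancel hα.ne', ENNReal.ofReal_one]
  refine h2.trans (add_le_add ((tsum_stopAt_log_le hρ hP hD pol).trans ?_) h3)
  have h4 : ENNReal.ofReal ((1 - ρ) / ρ) = ∑' n, ∑' h : Hist Y n,
      ENNReal.ofReal (1 - ρ) * preWt W ρ pol n h := by
    simp_rw [ENNReal.tsum_mul_left]
    rw [tsum_tsum_preWt W hρ, ← ENNReal.ofReal_mul h1ρ.le, mul_one_div]
  rw [ADD_eq W hρ, h4, ← ENNReal.tsum_add, ← ENNReal.tsum_mul_left, ← ENNReal.tsum_mul_right,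
    ← ENNReal.tsum_add]
  refine ENNReal.tsum_le_tsum fun n => ?_
  rw [← ENNReal.tsum_add, ← ENNReal.tsum_mul_left, ← ENNReal.tsum_mul_right,
    ← ENNReal.tsum_add]
  refine ENNReal.tsum_le_tsum fun h => ?_
  split_ifs
  · rw [add_assoc, ← add_mul, ofReal_add_ofReal_one_sub hρ, one_mul, mul_comm _ (ENNReal.ofReal
      (priorExp ρ)), mul_assoc]
  · exact zero_le

/-- The delay of a policy meeting both constraints, before the choice of the free parameter
`l`, which balances the covertness budget against the delay. -/
lemma delay_converse {W : Channel Y Z} {ρ : ℝ} (hρ : ρ ∈ Set.Ioo (0 : ℝ) 1)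
    (hP : aliceChannel W false true = aliceChannel W false false)
    (hD : gainD W < ∞) (hχ : chi W true < ∞) (hχ0 : 0 < (chi W true).toReal)
    (pol : Policy Y) {α δ l : ℝ} (hα : 0 < α) (hδ : 0 < δ) (hl : 0 < l)
    (hA : ADD W ρ pol < ∞) (hE : ECB W ρ pol ≤ ENNReal.ofReal δ)
    (hF : PFA W ρ pol ≤ ENNReal.ofReal α) :
    -Real.log (α / (1 - ρ)) ≤ priorExp ρ * ((ADD W ρ pol).toReal + (1 - ρ) / ρ) +
      (gainD W).toReal * (l * δ / (2 * (chi W true).toReal) + (ADD W ρ pol).toReal / (2 * l)) := by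
  classical
  have h1ρ : 0 < 1 - ρ := by linarith [hρ.2]
  have hρ0 := hρ.1
  have hd := priorExp_pos hρ
  set χ := (chi W true).toReal with hχd
  have hχe : chi W true = ENNReal.ofReal χ := (ENNReal.ofReal_toReal hχ.ne).symm
  have hDe : gainD W = ENNReal.ofReal (gainD W).toReal := (ENNReal.ofReal_toReal hD.ne).symm
  have hAe : ADD W ρ pol = ENNReal.ofReal (ADD W ρ pol).toReal :=
    (ENNReal.ofReal_toReal hA.ne).symm
  set D := (gainD W).toReal
  set A := (ADD W ρ pol).toReal
  have hD0 : 0 ≤ D := ENNReal.toReal_nonneg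
  have hA0 : 0 ≤ A := ENNReal.toReal_nonneg
  have hsum : (∑' n, ∑' h : Hist Y n, postWt W ρ pol n h * ENNReal.ofReal (pol.effSense n h)) ≤
      ENNReal.ofReal (l * δ / (2 * χ) + A / (2 * l)) := by
    -- `e ≤ (l / 2) e² + 1 / (2 l)` for the sensing probability `e`
    have h1 : ∀ n, ∀ h : Hist Y n, postWt W ρ pol n h * ENNReal.ofReal (pol.effSense n h) ≤
        ENNReal.ofReal (l / (2 * χ)) *
          ((chi W true * postWt W ρ pol n h + chi W false * preWt W ρ pol n h) *
            ENNReal.ofReal ((pol.effSense n h : ℝ) ^ 2)) +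
        ENNReal.ofReal (1 / (2 * l)) * (if pol.Alive n h then
          postWt W ρ pol n h + ENNReal.ofReal ρ * preWt W ρ pol n h else 0) := by
      intro n h
      split_ifs with ha
      · set e : ℝ := (pol.effSense n h : ℝ) with he
        have he0 : 0 ≤ e := (pol.effSense n h).2.1
        calc _ ≤ postWt W ρ pol n h * ENNReal.ofReal (l / 2 * e ^ 2 + 1 / (2 * l)) := by
              gcongr
              have : l / 2 * e ^ 2 + 1 / (2 * l) - e = (l * e - 1) ^ 2 / (2 * l) := by
                field_simp; ring
              have : 0 ≤ (l * e - 1) ^ 2 / (2 * l) := by positivity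
              linarith
          _ = ENNReal.ofReal (l / (2 * χ)) * ((chi W true * postWt W ρ pol n h) *
                ENNReal.ofReal (e ^ 2)) + ENNReal.ofReal (1 / (2 * l)) * postWt W ρ pol n h := by
              rw [ENNReal.ofReal_add (by positivity) (by positivity), hχe]
              have : l / 2 * e ^ 2 = l / (2 * χ) * χ * e ^ 2 := by field_simp
              rw [this, ENNReal.ofReal_mul (by positivity), ENNReal.ofReal_mul (by positivity)]
              ring
          _ ≤ _ := by
              gcongr <;> exact le_self_add
      · rw [Policy.effSense_of_not_alive ha]
        simp
    calc _ ≤ _ := ENNReal.tsum_le_tsum fun n => ENNReal.tsum_le_tsum fun h => h1 n h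
      _ = ENNReal.ofReal (l / (2 * χ)) * ECB W ρ pol +
          ENNReal.ofReal (1 / (2 * l)) * ADD W ρ pol := by
          simp_rw [ENNReal.tsum_add, ENNReal.tsum_mul_left]
          rw [← ECB_eq W hρ, ← ADD_eq W hρ]
      _ ≤ ENNReal.ofReal (l / (2 * χ)) * ENNReal.ofReal δ +
          ENNReal.ofReal (1 / (2 * l)) * ENNReal.ofReal A := by
          rw [← hAe]; gcongr
      _ = _ := by
          rw [← ENNReal.ofReal_mul (by positivity), ← ENNReal.ofReal_mul (by positivity),
            ← ENNReal.ofReal_add (by positivity) (by positivity)]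
          congr 1
          field_simp
  have h2 := le_tsum_stopAt_log hρ hP hD pol hα hA hF
  have h3 : ENNReal.ofReal (1 - Real.log (α / (1 - ρ))) ≤ ENNReal.ofReal
      (priorExp ρ * (A + (1 - ρ) / ρ) + D * (l * δ / (2 * χ) + A / (2 * l)) + 1) := by
    refine h2.trans ?_
    rw [ENNReal.ofReal_add (by positivity) zero_le_one, ENNReal.ofReal_add (by positivity)
      (by positivity), ENNReal.ofReal_mul hd.le, ENNReal.ofReal_add hA0 (by positivity), ← hAe,
      mul_comm D, ENNReal.ofReal_mul (by positivity), ← hDe, ENNReal.ofReal_one]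
    gcongr
  have h4 := (ENNReal.ofReal_le_ofReal_iff (by positivity)).1 h3
  linarith

end

/-! ### A Lyapunov function for first passage -/

/-- Consider a random walk with i.i.d. steps `ξ` of mean `m > 0` and second moment at most `Q`,
started at distance `w - Q / m` below its target. The function `v` bounds `m` times the expected time to
reach the target: it is the distance `w`, corrected by the bounded convex function
`φ w = 𝔼[((ξ - w)⁺)²] / m` to pay for the expected overshoot `e w = 𝔼[(ξ - w)⁺]`. -/
lemma exists_lyapunov {Ω : Type*} [MeasurableSpace Ω] (ν : Measure Ω) [IsProbabilityMeasure ν]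
    {ξ : Ω → ℝ} (hξ : Measurable ξ) (hi : Integrable ξ ν) (hi2 : Integrable (fun ω => ξ ω ^ 2) ν)
    {m Q : ℝ} (hm : ∫ ω, ξ ω ∂ν = m) (hm0 : 0 < m) (hQ : ∫ ω, ξ ω ^ 2 ∂ν ≤ Q) :
    ∃ v : ℝ → ℝ, Monotone v ∧ (∀ w, 0 ≤ v w) ∧ (∀ w, 0 ≤ w → v w ≤ w + Q / m) ∧
      ∀ w, 0 < w → Q ≤ m * w →
        ∫⁻ ω, ENNReal.ofReal (v (w - ξ ω)) ∂ν + ENNReal.ofReal m ≤ ENNReal.ofReal (v w) := by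
  set e : ℝ → ℝ := fun w => ∫ ω, max (ξ ω - w) 0 ∂ν with he
  set φ : ℝ → ℝ := fun w => (1 / m) * ∫ ω, (max (ξ ω - w) 0) ^ 2 ∂ν with hφ
  have hei : ∀ w, Integrable (fun ω => max (ξ ω - w) 0) ν := fun w =>
    (hi.sub (integrable_const w)).pos_part
  have hφi : ∀ w, Integrable (fun ω => (max (ξ ω - w) 0) ^ 2) ν := fun w => by
    refine Integrable.mono' ((hi2.const_mul 2).add (integrable_const (2 * w ^ 2)))
      (by fun_prop) (Filter.Eventually.of_forall fun ω => ?_)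
    rw [Real.norm_of_nonneg (by positivity)]
    simp only [Pi.add_apply]
    rcases max_cases (ξ ω - w) 0 with ⟨h1, _⟩ | ⟨h1, _⟩ <;> rw [h1] <;>
      nlinarith [sq_nonneg (ξ ω + w), sq_nonneg (ξ ω), sq_nonneg w]
  have he0 : ∀ w, 0 ≤ e w := fun w => integral_nonneg fun ω => le_max_right _ _
  have hφ0 : ∀ w, 0 ≤ φ w := fun w =>
    mul_nonneg (by positivity) (integral_nonneg fun ω => by positivity)
  have hφanti : ∀ {a b}, a ≤ b → φ b ≤ φ a := by
    intro a b hab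
    refine mul_le_mul_of_nonneg_left (integral_mono (hφi b) (hφi a) fun ω => ?_) (by positivity)
    have : max (ξ ω - b) 0 ≤ max (ξ ω - a) 0 := max_le_max (by linarith) le_rfl
    exact pow_le_pow_left₀ (le_max_right _ _) this 2
  -- the tangent line of the convex function `φ` at `w`
  have htan : ∀ w x, φ w + 2 / m * e w * x ≤ φ (w - x) := by
    intro w x
    have h1 : ∫ ω, ((max (ξ ω - w) 0) ^ 2 + 2 * x * max (ξ ω - w) 0) ∂ν ≤
        ∫ ω, (max (ξ ω - (w - x)) 0) ^ 2 ∂ν := by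
      refine integral_mono ((hφi w).add ((hei w).const_mul _)) (hφi (w - x)) fun ω => ?_
      show (max (ξ ω - w) 0) ^ 2 + 2 * x * max (ξ ω - w) 0 ≤ (max (ξ ω - (w - x)) 0) ^ 2
      rcases max_cases (ξ ω - w) 0 with ⟨h1, h1'⟩ | ⟨h1, h1'⟩ <;>
      rcases max_cases (ξ ω - (w - x)) 0 with ⟨h2, h2'⟩ | ⟨h2, h2'⟩ <;> rw [h1, h2] <;>
        nlinarith [sq_nonneg x]
    rw [integral_add (hφi w) ((hei w).const_mul _), integral_const_mul] at h1
    have h2 := mul_le_mul_of_nonneg_left h1 (by positivity : 0 ≤ 1 / m)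
    calc φ w + 2 / m * e w * x = 1 / m * (∫ ω, (max (ξ ω - w) 0) ^ 2 ∂ν + 2 * x * e w) := by
          simp only [hφ]; ring
      _ ≤ _ := h2
  have hφQ : φ 0 ≤ Q / m := by
    have h1 : ∫ ω, (max (ξ ω - 0) 0) ^ 2 ∂ν ≤ Q := by
      refine (integral_mono (hφi 0) hi2 fun ω => ?_).trans hQ
      show (max (ξ ω - 0) 0) ^ 2 ≤ ξ ω ^ 2
      rcases max_cases (ξ ω - 0) 0 with ⟨h1, h1'⟩ | ⟨h1, h1'⟩ <;> rw [h1] <;>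
        nlinarith [sq_nonneg (ξ ω)]
    calc φ 0 = 1 / m * ∫ ω, (max (ξ ω - 0) 0) ^ 2 ∂ν := rfl
      _ ≤ 1 / m * Q := by gcongr
      _ = Q / m := by ring
  set v : ℝ → ℝ := fun w => if 0 ≤ w then w - φ w + φ 0 else 0 with hv
  have hv0 : ∀ w, 0 ≤ v w := by
    intro w
    simp only [hv]
    split_ifs with h
    · linarith [hφanti h]
    · exact le_rfl
  have hvmono : Monotone v := by
    intro a b hab
    by_cases ha : 0 ≤ a
    · simp only [hv, if_pos ha, if_pos (ha.trans hab)]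
      linarith [hφanti hab]
    · have : v a = 0 := if_neg ha
      rw [this]; exact hv0 b
  refine ⟨v, hvmono, hv0, ?_, ?_⟩
  · intro w hw
    simp only [hv, if_pos hw]
    linarith [hφ0 w]
  · intro w hw hQw
    -- `(x - w)⁺ ≤ x² / (4 w)`
    have hew : e w ≤ m / 4 := by
      have h1 : e w ≤ 1 / (4 * w) * ∫ ω, ξ ω ^ 2 ∂ν := by
        rw [← integral_const_mul]
        refine integral_mono (hei w) (hi2.const_mul _) fun ω => ?_
        show max (ξ ω - w) 0 ≤ 1 / (4 * w) * ξ ω ^ 2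
        refine max_le ?_ (by positivity)
        have : 1 / (4 * w) * ξ ω ^ 2 - (ξ ω - w) = (ξ ω - 2 * w) ^ 2 / (4 * w) := by
          field_simp; ring
        have : 0 ≤ (ξ ω - 2 * w) ^ 2 / (4 * w) := by positivity
        linarith
      calc e w ≤ 1 / (4 * w) * (m * w) := h1.trans (by gcongr; exact hQ.trans hQw)
        _ = m / 4 := by field_simp
    -- `u` dominates the new value of `v`: linear part, overshoot and tangent line of `φ`
    set u : Ω → ℝ := fun ω => (w + φ 0 - φ w) - (1 + 2 / m * e w) * ξ ω +
      (1 + 2 / m * e w) * max (ξ ω - w) 0 with hu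
    have hle : ∀ ω, v (w - ξ ω) ≤ u ω := by
      intro ω
      simp only [hv, hu]
      split_ifs with h
      · rw [max_eq_right (by linarith)]
        have := htan w (ξ ω)
        linarith
      · rw [max_eq_left (by linarith)]
        have := htan w w
        rw [sub_self] at this
        linarith
    have hui1 : Integrable (fun ω => (w + φ 0 - φ w) - (1 + 2 / m * e w) * ξ ω) ν :=
      (integrable_const _).sub (hi.const_mul _)
    have hui : Integrable u ν := hui1.add ((hei w).const_mul _)
    have hint : ∫ ω, u ω ∂ν = (w + φ 0 - φ w) - (1 + 2 / m * e w) * m +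
        (1 + 2 / m * e w) * e w := by
      simp only [hu]
      rw [integral_add hui1 ((hei w).const_mul _), integral_sub (integrable_const _)
        (hi.const_mul _), integral_const_mul, integral_const_mul, hm]
      simp [he]
    have hu0 : ∀ ω, 0 ≤ u ω := fun ω => (hv0 _).trans (hle ω)
    calc ∫⁻ ω, ENNReal.ofReal (v (w - ξ ω)) ∂ν + ENNReal.ofReal m
        ≤ ∫⁻ ω, ENNReal.ofReal (u ω) ∂ν + ENNReal.ofReal m := by
          gcongr with ω; exact hle ω
      _ = ENNReal.ofReal (∫ ω, u ω ∂ν + m) := by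
          rw [← ofReal_integral_eq_lintegral_ofReal hui (Filter.Eventually.of_forall hu0),
            ← ENNReal.ofReal_add (integral_nonneg hu0) hm0.le]
      _ ≤ ENNReal.ofReal (v w) := by
          apply ENNReal.ofReal_le_ofReal
          simp only [hint, hv, if_pos hw.le]
          have h1 : (1 + 2 / m * e w) * m = m + 2 * e w := by field_simp
          have h2 : 2 / m * e w ≤ 1 / 2 := by
            calc 2 / m * e w ≤ 2 / m * (m / 4) := by gcongr
              _ = 1 / 2 := by field_simp; norm_num
          have h3 := mul_le_mul_of_nonneg_right h2 (he0 w)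
          have h4 := he0 w
          rw [h1, add_mul (1 : ℝ)]
          linarith

section
variable [MeasurableSpace Y] [MeasurableSpace Z] [Countable Y] [Countable Z]
  [DiscreteMeasurableSpace Y] [DiscreteMeasurableSpace Z]

/-! ### Moments of one round -/

lemma lintegral_roundLaw (W : Channel Y Z) (p : unitInterval) (θ : Bool) (g : Bool × Y → ℝ≥0∞) :
    ∫⁻ s, g (s.1, s.2.1) ∂(roundLaw W p θ) = ∑' r, stepWt W p θ r * g r := by
  have hm : Measurable fun s : Bool × Y × Z => (s.1, s.2.1) := by fun_prop
  rw [← lintegral_map (f := g) Measurable.of_discrete hm, lintegral_countable']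
  refine tsum_congr fun r => ?_
  rw [Measure.map_apply hm MeasurableSet.of_discrete, mul_comm, ← roundLaw_apply]
  rfl

lemma integral_log_probeRatio {W : Channel Y Z} (hD : gainD W < ∞) :
    ∫ y, Real.log (probeRatio W y) ∂(aliceChannel W true true).toMeasure = (gainD W).toReal := by
  have hac := absolutelyContinuous_of_gainD hD
  rw [gainD, toReal_klDiv_of_measure_eq hac (by simp)]
  refine integral_congr_ae ?_
  filter_upwards [hac.ae_le (rnDeriv_PMF (absCont_of_toMeasure hac))] with y hy
  rw [llr, hy, ENNReal.toReal_ofReal (by positivity), probeRatio]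

/-- The increment of the logarithm of the posterior odds in a post-change round, up to the
contribution of a change in that very round. -/
noncomputable def logIncr (W : Channel Y Z) (ρ : ℝ) (s : Bool × Y × Z) : ℝ :=
  priorExp ρ + Real.log (roundRatio W (s.1, s.2.1))

lemma lintegral_log_roundRatio_sq (W : Channel Y Z) (p : unitInterval) :
    ∫⁻ s, ENNReal.ofReal (Real.log (roundRatio W (s.1, s.2.1)) ^ 2) ∂(roundLaw W p true) =
      ENNReal.ofReal p * gainV W := by
  rw [lintegral_roundLaw W p true fun r => ENNReal.ofReal (Real.log (roundRatio W r) ^ 2),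
    tsum_stepWt_mul]
  simp [roundRatio, probeRatio, gainV, relVar]

lemma memLp_log_roundRatio {W : Channel Y Z} (hV : gainV W < ∞) (p : unitInterval) :
    MemLp (fun s => Real.log (roundRatio W (s.1, s.2.1))) 2 (roundLaw W p true) := by
  rw [memLp_two_iff_integrable_sq Measurable.of_discrete.aestronglyMeasurable]
  refine (lintegral_ofReal_ne_top_iff_integrable
    Measurable.of_discrete.aestronglyMeasurable
    (Filter.Eventually.of_forall fun s => sq_nonneg _)).1 ?_
  rw [lintegral_log_roundRatio_sq]
  exact ENNReal.mul_ne_top ENNReal.ofReal_ne_top hV.ne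

lemma integral_log_roundRatio_sq {W : Channel Y Z} (p : unitInterval) :
    ∫ s, Real.log (roundRatio W (s.1, s.2.1)) ^ 2 ∂(roundLaw W p true) = p * (gainV W).toReal := by
  rw [integral_eq_lintegral_of_nonneg_ae (Filter.Eventually.of_forall fun s => sq_nonneg _)
    Measurable.of_discrete.aestronglyMeasurable, lintegral_log_roundRatio_sq, ENNReal.toReal_mul,
    ENNReal.toReal_ofReal p.2.1]

lemma integral_log_roundRatio {W : Channel Y Z} (hD : gainD W < ∞) (hV : gainV W < ∞)
    (p : unitInterval) :
    ∫ s, Real.log (roundRatio W (s.1, s.2.1)) ∂(roundLaw W p true) = p * (gainD W).toReal := by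
  have hi := (memLp_log_roundRatio hV p).integrable (by norm_num)
  have hfst : (aliceChannel W true true).toMeasure =
      (W true true).toMeasure.map Prod.fst := (PMF.toMeasure_map _ (W true true) measurable_fst).symm
  rw [roundLaw] at hi ⊢
  rw [integral_add_measure hi.left_of_add_measure hi.right_of_add_measure, integral_smul_measure,
    integral_smul_measure, integral_map measurable_prodMk_left.aemeasurable
    Measurable.of_discrete.aestronglyMeasurable, integral_map measurable_prodMk_left.aemeasurable
    Measurable.of_discrete.aestronglyMeasurable, ← integral_log_probeRatio hD, hfst,
    integral_map measurable_fst.aemeasurable Measurable.of_discrete.aestronglyMeasurable]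
  simp [roundRatio, ENNReal.toReal_ofReal p.2.1]

/-- A bound for the second moment of `logIncr`, uniform in the sensing probability. -/
noncomputable def momentBound (W : Channel Y Z) (ρ : ℝ) : ℝ :=
  (gainV W).toReal + 2 * priorExp ρ * (gainD W).toReal + priorExp ρ ^ 2

/-- The Lyapunov function for the walk with steps `logIncr`, with constants that do not depend on
the sensing probability. -/
lemma exists_lyapunov_round {W : Channel Y Z} {ρ : ℝ} (hρ : ρ ∈ Set.Ioo (0 : ℝ) 1)
    (hD : gainD W < ∞) (hV : gainV W < ∞) (p : unitInterval) :
    ∃ v : ℝ → ℝ, Monotone v ∧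
      (∀ w, 0 ≤ w → v w ≤ w + momentBound W ρ / priorExp ρ) ∧
      ∀ w, 0 < w → momentBound W ρ ≤ priorExp ρ * w →
        ∑' r, stepWt W p true r *
            ENNReal.ofReal (v (w - (priorExp ρ + Real.log (roundRatio W r)))) +
          ENNReal.ofReal (priorExp ρ + p * (gainD W).toReal) ≤ ENNReal.ofReal (v w) := by
  have hd := priorExp_pos hρ
  have hD0 : 0 ≤ (gainD W).toReal := ENNReal.toReal_nonneg
  have hV0 : 0 ≤ (gainV W).toReal := ENNReal.toReal_nonneg
  have hp0 := p.2.1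
  have hp1 := p.2.2
  have hQ0 : 0 ≤ momentBound W ρ := by unfold momentBound; positivity
  have hL := memLp_log_roundRatio hV p
  have hi := hL.integrable (by norm_num)
  have hi2 := hL.integrable_sq
  have hξi : Integrable (logIncr W ρ) (roundLaw W p true) := (integrable_const _).add hi
  have hsq : ∀ s, logIncr W ρ s ^ 2 = (priorExp ρ ^ 2 +
      2 * priorExp ρ * Real.log (roundRatio W (s.1, s.2.1))) +
      Real.log (roundRatio W (s.1, s.2.1)) ^ 2 := fun s => by rw [logIncr]; ring
  have hA : Integrable (fun s => priorExp ρ ^ 2 +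
      2 * priorExp ρ * Real.log (roundRatio W (s.1, s.2.1))) (roundLaw W p true) :=
    (integrable_const _).add (hi.const_mul _)
  have hξi2 : Integrable (fun s => logIncr W ρ s ^ 2) (roundLaw W p true) := by
    simp_rw [hsq]; exact hA.add hi2
  have hm : ∫ s, logIncr W ρ s ∂(roundLaw W p true) = priorExp ρ + p * (gainD W).toReal := by
    simp only [logIncr]
    rw [integral_add (integrable_const _) hi, integral_log_roundRatio hD hV]
    simp
  have hQ : ∫ s, logIncr W ρ s ^ 2 ∂(roundLaw W p true) ≤ momentBound W ρ := by
    simp_rw [hsq]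
    rw [integral_add hA hi2, integral_add (integrable_const _) (hi.const_mul _),
      integral_const_mul, integral_log_roundRatio hD hV, integral_log_roundRatio_sq]
    simp only [integral_const, probReal_univ, one_smul, momentBound]
    have h1 : (p : ℝ) * (gainV W).toReal ≤ (gainV W).toReal := mul_le_of_le_one_left hV0 hp1
    have h2 : 2 * priorExp ρ * (p * (gainD W).toReal) ≤ 2 * priorExp ρ * (gainD W).toReal := by
      gcongr; exact mul_le_of_le_one_left hD0 hp1
    linarith
  obtain ⟨v, h1, h2, h3, h4⟩ := exists_lyapunov (roundLaw W p true)
    Measurable.of_discrete hξi hξi2 hm (by positivity) hQ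
  have hmd : priorExp ρ ≤ priorExp ρ + p * (gainD W).toReal := by
    linarith [mul_nonneg hp0 hD0]
  refine ⟨v, h1, fun w hw => (h3 w hw).trans (by gcongr), fun w hw hw' => ?_⟩
  have h5 := h4 w hw (hw'.trans (by gcongr))
  rw [← lintegral_roundLaw W p true
    fun r => ENNReal.ofReal (v (w - (priorExp ρ + Real.log (roundRatio W r))))]
  exact h5

/-! ### The delay of the Shiryaev rule -/

/-- The expected number of active rounds after the change is at most that of the first passage of
the random walk `logIncr` over the level `ln ((1 - α) / α) + C_ρ`. -/
lemma IsShiryaev.tsum_alive_postWt_le {W : Channel Y Z} {ρ α β : ℝ} {pol : Policy Y}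
    (hS : IsShiryaev W ρ α β pol) (hρ : ρ ∈ Set.Ioo (0 : ℝ) 1)
    (hP : aliceChannel W false true = aliceChannel W false false)
    (hD : gainD W < ∞) (hV : gainV W < ∞) (hα : 0 < α) (hα1 : α < 1) (hβ : β ∈ Set.Icc (0 : ℝ) 1)
    (hb : 0 ≤ Real.log ((1 - α) / α) + constC ρ) [∀ n h, Decidable (pol.Alive n h)] :
    (∑' n, ∑' h : Hist Y n, if pol.Alive n h then postWt W ρ pol n h else 0) ≤
      ENNReal.ofReal ((Real.log ((1 - α) / α) + constC ρ + 2 * (momentBound W ρ / priorExp ρ)) /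
        (priorExp ρ + β * (gainD W).toReal)) := by
  have hac := absCont_of_toMeasure (absolutelyContinuous_of_gainD hD)
  have hd := priorExp_pos hρ
  have h1ρ : 0 < 1 - ρ := by linarith [hρ.2]
  have hρ0 := hρ.1
  have hD0 : 0 ≤ (gainD W).toReal := ENNReal.toReal_nonneg
  have hV0 : 0 ≤ (gainV W).toReal := ENNReal.toReal_nonneg
  have hβ0 := hβ.1
  have hQ0 : 0 < momentBound W ρ := by unfold momentBound; positivity
  obtain ⟨v, hvm, hvle, hvd⟩ := exists_lyapunov_round hρ hD hV ⟨β, hβ⟩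
  set m := priorExp ρ + β * (gainD W).toReal with hm
  have hm0 : 0 < m := by positivity
  set K := momentBound W ρ / priorExp ρ with hK
  have hK0 : 0 < K := by positivity
  set r := (1 - α) / α with hr
  have hr0 : 0 < r := div_pos (by linarith) hα
  -- the distance to the threshold on the logarithmic scale, shifted by `K`
  set dist : ℝ → ℝ := fun R => K + Real.log r - Real.log R with hdist
  set wmax := Real.log r + constC ρ + K with hwmax
  -- one round lowers the potential by `m` per unit of active post-change mass, while the changes
  -- occurring in that round enter at distance at most `wmax`
  have hstep : ∀ n, (∑' h : Hist Y (n + 1), if pol.Alive (n + 1) h then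
        postWt W ρ pol (n + 1) h * ENNReal.ofReal (v (dist (odds W ρ (n + 1) h))) else 0) +
      ENNReal.ofReal m * (∑' h : Hist Y n, if pol.Alive n h then postWt W ρ pol n h else 0) ≤
      (∑' h : Hist Y n, if pol.Alive n h then
        postWt W ρ pol n h * ENNReal.ofReal (v (dist (odds W ρ n h))) else 0) +
      ENNReal.ofReal ρ * ENNReal.ofReal (v wmax) * ∑' h, preWt W ρ pol n h := by
    intro n
    have h1 : ∀ h : Hist Y (n + 1), (if pol.Alive (n + 1) h then
        postWt W ρ pol (n + 1) h * ENNReal.ofReal (v (dist (odds W ρ (n + 1) h))) else 0) ≤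
        (fun (h : Hist Y n) q => if pol.Alive n h then
          postWt W ρ pol n h * (stepWt W (pol.effSense n h) true q * ENNReal.ofReal
            (v (dist (odds W ρ n h) - (priorExp ρ + Real.log (roundRatio W q))))) +
          ENNReal.ofReal ρ * ENNReal.ofReal (v wmax) * preWt W ρ pol n h *
            stepWt W (pol.effSense n h) false q else 0) (Fin.init h) (h (Fin.last n)) := by
      intro h
      by_cases ha : pol.Alive (n + 1) h
      · have ha' := ((pol.alive_succ n h).1 ha).1
        simp only [if_pos ha, if_pos ha']
        have hR := odds_nonneg W hρ n (Fin.init h)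
        have ht := roundRatio_nonneg W (h (Fin.last n))
        have ho : odds W ρ (n + 1) h =
          (odds W ρ n (Fin.init h) * roundRatio W (h (Fin.last n)) + ρ) / (1 - ρ) := rfl
        rw [postWt_succ W hρ, add_mul]
        refine add_le_add ?_ ?_
        · by_cases hz : postWt W ρ pol n (Fin.init h) *
              stepWt W (pol.effSense n (Fin.init h)) true (h (Fin.last n)) = 0
          · rw [hz, zero_mul]; exact zero_le
          · rw [← mul_assoc]
            gcongr
            apply hvm
            rw [postWt_eq W hρ hP hac, stepWt_true W hP hac] at hz
            have hR' : 0 < odds W ρ n (Fin.init h) := by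
              refine lt_of_le_of_ne hR fun h0 => hz ?_
              rw [← h0]; simp
            have ht' : 0 < roundRatio W (h (Fin.last n)) := by
              refine lt_of_le_of_ne ht fun h0 => hz ?_
              rw [← h0]; simp
            have h2 : Real.log (odds W ρ n (Fin.init h) * roundRatio W (h (Fin.last n)) / (1 - ρ))
                ≤ Real.log (odds W ρ (n + 1) h) := by
              apply Real.log_le_log (by positivity)
              rw [ho]; gcongr; linarith
            rw [Real.log_div (by positivity) h1ρ.ne', Real.log_mul hR'.ne' ht'.ne'] at h2
            simp only [hdist]
            rw [priorExp_eq hρ]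
            linarith
        · calc _ ≤ ENNReal.ofReal ρ * preWt W ρ pol n (Fin.init h) *
                stepWt W (pol.effSense n (Fin.init h)) false (h (Fin.last n)) *
                ENNReal.ofReal (v wmax) := by
                gcongr
                apply hvm
                have h2 : Real.log (ρ / (1 - ρ)) ≤ Real.log (odds W ρ (n + 1) h) := by
                  apply Real.log_le_log (by positivity)
                  rw [ho]; gcongr; linarith [mul_nonneg hR ht]
                have h3 : constC ρ = - Real.log (ρ / (1 - ρ)) := by
                  rw [constC, ← Real.log_inv, inv_div]
                simp only [hdist, hwmax, h3]
                linarith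
            _ = _ := by ring
      · rw [if_neg ha]; exact zero_le
    refine (add_le_add_left (ENNReal.tsum_le_tsum h1) _).trans ?_
    rw [tsum_hist_succ n (fun (h : Hist Y n) q => if pol.Alive n h then
          postWt W ρ pol n h * (stepWt W (pol.effSense n h) true q * ENNReal.ofReal
            (v (dist (odds W ρ n h) - (priorExp ρ + Real.log (roundRatio W q))))) +
          ENNReal.ofReal ρ * ENNReal.ofReal (v wmax) * preWt W ρ pol n h *
            stepWt W (pol.effSense n h) false q else 0), ← ENNReal.tsum_mul_left,
      ← ENNReal.tsum_mul_left, ← ENNReal.tsum_add, ← ENNReal.tsum_add]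
    refine ENNReal.tsum_le_tsum fun h => ?_
    by_cases ha : pol.Alive n h
    · simp only [if_pos ha]
      rw [ENNReal.tsum_add, ENNReal.tsum_mul_left, ENNReal.tsum_mul_left, tsum_stepWt, mul_one,
        add_right_comm]
      gcongr ?_ + _
      by_cases hz : postWt W ρ pol n h = 0
      · simp [hz]
      · have hz' := hz
        rw [postWt_eq W hρ hP hac] at hz'
        have hlt := hS.odds_lt_of_alive hρ hP hac (right_ne_zero_of_mul hz') ha
        have hR := odds_nonneg W hρ n h
        have hR' : 0 < odds W ρ n h := by
          refine lt_of_le_of_ne hR fun h0 => hz' ?_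
          rw [← h0]; simp
        have hlog : Real.log (odds W ρ n h) ≤ Real.log r := by
          apply Real.log_le_log hR'
          rw [hr, le_div_iff₀ hα]; linarith
        have heff : pol.effSense n h = ⟨β, hβ⟩ := by
          rw [Policy.effSense_of_alive ha]
          exact Subtype.ext (hS.1 n h)
        have hw : K ≤ dist (odds W ρ n h) := by simp only [hdist]; linarith
        have := hvd (dist (odds W ρ n h)) (lt_of_lt_of_le hK0 hw) (by
          calc momentBound W ρ = priorExp ρ * K := by rw [hK]; field_simp
            _ ≤ _ := by gcongr)
        rw [heff, mul_comm (ENNReal.ofReal m), ← mul_add]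
        gcongr
    · simp [ha]
  have hsum : ∀ n, (∑' h : Hist Y n, if pol.Alive n h then
        postWt W ρ pol n h * ENNReal.ofReal (v (dist (odds W ρ n h))) else 0) +
      ENNReal.ofReal m * (∑ k ∈ Finset.range n, ∑' h : Hist Y k,
        if pol.Alive k h then postWt W ρ pol k h else 0) ≤
      ENNReal.ofReal ρ * ENNReal.ofReal (v wmax) *
        ∑ k ∈ Finset.range n, ∑' h, preWt W ρ pol k h := by
    intro n
    induction n with
    | zero => simp [postWt_zero]
    | succ n ih =>
      rw [Finset.sum_range_succ, Finset.sum_range_succ, mul_add, mul_add,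
        add_comm (ENNReal.ofReal m * _), ← add_assoc]
      refine (add_le_add_left (hstep n) _).trans ?_
      rw [add_right_comm]
      exact add_le_add_left ih _
  have hfin : ENNReal.ofReal m * (∑' n, ∑' h : Hist Y n,
      if pol.Alive n h then postWt W ρ pol n h else 0) ≤ ENNReal.ofReal (v wmax) := by
    rw [← ENNReal.tsum_mul_left]
    refine ENNReal.tsum_le_of_sum_range_le fun n => ?_
    rw [← Finset.mul_sum]
    refine (le_add_self.trans (hsum n)).trans ?_
    refine (mul_le_mul_right (ENNReal.sum_le_tsum _) _).trans ?_
    rw [tsum_tsum_preWt W hρ, mul_right_comm, ← ENNReal.ofReal_mul hρ0.le, mul_one_div_cancel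
      hρ0.ne', ENNReal.ofReal_one, one_mul]
  have hvw : v wmax ≤ Real.log r + constC ρ + 2 * K := by
    have := hvle wmax (by linarith)
    linarith
  rw [ENNReal.ofReal_div_of_pos hm0, ENNReal.le_div_iff_mul_le
    (Or.inl (by simpa using hm0)) (Or.inl ENNReal.ofReal_ne_top), mul_comm]
  exact hfin.trans (ENNReal.ofReal_le_ofReal hvw)

/-- The round in which the change occurs adds at most `1` to the delay. -/
lemma IsShiryaev.ADD_le {W : Channel Y Z} {ρ α β : ℝ} {pol : Policy Y}
    (hS : IsShiryaev W ρ α β pol) (hρ : ρ ∈ Set.Ioo (0 : ℝ) 1)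
    (hP : aliceChannel W false true = aliceChannel W false false)
    (hD : gainD W < ∞) (hV : gainV W < ∞) (hα : 0 < α) (hα1 : α < 1) (hβ : β ∈ Set.Icc (0 : ℝ) 1)
    (hb : 0 ≤ Real.log ((1 - α) / α) + constC ρ) :
    ADD W ρ pol ≤
      ENNReal.ofReal ((Real.log ((1 - α) / α) + constC ρ + 2 * (momentBound W ρ / priorExp ρ)) /
        (priorExp ρ + β * (gainD W).toReal)) + 1 := by
  classical
  have h1 : ∀ n, ∀ h : Hist Y n, (if pol.Alive n h then
      postWt W ρ pol n h + ENNReal.ofReal ρ * preWt W ρ pol n h else 0) ≤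
      (if pol.Alive n h then postWt W ρ pol n h else 0) +
        ENNReal.ofReal ρ * preWt W ρ pol n h := by
    intro n h; split_ifs
    · exact le_rfl
    · exact zero_le
  rw [ADD_eq W hρ]
  refine (ENNReal.tsum_le_tsum fun n => ENNReal.tsum_le_tsum fun h => h1 n h).trans ?_
  simp_rw [ENNReal.tsum_add, ENNReal.tsum_mul_left]
  rw [tsum_tsum_preWt W hρ, ← ENNReal.ofReal_mul hρ.1.le, mul_one_div_cancel hρ.1.ne',
    ENNReal.ofReal_one]
  gcongr
  exact hS.tsum_alive_postWt_le hρ hP hD hV hα hα1 hβ hb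

/-- The budget spent by the Shiryaev policy: the pre-change period has mean `1 / ρ`, and `T` bounds
the mean active time after the change. -/
lemma IsShiryaev.ECB_le {W : Channel Y Z} {ρ α β : ℝ} {pol : Policy Y}
    (hS : IsShiryaev W ρ α β pol) (hρ : ρ ∈ Set.Ioo (0 : ℝ) 1)
    (hP : aliceChannel W false true = aliceChannel W false false)
    (hD : gainD W < ∞) (hV : gainV W < ∞) (hχ : ∀ θ, chi W θ < ∞)
    (hα : 0 < α) (hα1 : α < 1) (hβ : β ∈ Set.Icc (0 : ℝ) 1)
    (hb : 0 ≤ Real.log ((1 - α) / α) + constC ρ) {T : ℝ} (hT0 : 0 ≤ T)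
    (hT : (Real.log ((1 - α) / α) + constC ρ + 2 * (momentBound W ρ / priorExp ρ)) /
        (priorExp ρ + β * (gainD W).toReal) ≤ T) :
    ECB W ρ pol ≤
      ENNReal.ofReal (β ^ 2 * ((chi W false).toReal / ρ + (chi W true).toReal * T)) := by
  classical
  have hρ0 := hρ.1
  have h1 : ∀ n, ∀ h : Hist Y n,
      (chi W true * postWt W ρ pol n h + chi W false * preWt W ρ pol n h) *
      ENNReal.ofReal ((pol.effSense n h : ℝ) ^ 2) ≤
      ENNReal.ofReal (β ^ 2) * (chi W false * preWt W ρ pol n h + chi W true *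
        (if pol.Alive n h then postWt W ρ pol n h else 0)) := by
    intro n h
    by_cases ha : pol.Alive n h
    · rw [Policy.effSense_of_alive ha, hS.1, if_pos ha]
      apply le_of_eq; ring
    · rw [Policy.effSense_of_not_alive ha]; simp
  rw [ECB_eq W hρ]
  refine (ENNReal.tsum_le_tsum fun n => ENNReal.tsum_le_tsum fun h => h1 n h).trans ?_
  simp_rw [ENNReal.tsum_mul_left, ENNReal.tsum_add, ENNReal.tsum_mul_left]
  rw [tsum_tsum_preWt W hρ, ENNReal.ofReal_mul (by positivity), ENNReal.ofReal_add (by positivity)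
    (by positivity), ENNReal.ofReal_mul ENNReal.toReal_nonneg,
    div_eq_mul_one_div (chi W false).toReal,
    ENNReal.ofReal_mul ENNReal.toReal_nonneg, ENNReal.ofReal_toReal (hχ _).ne,
    ENNReal.ofReal_toReal (hχ _).ne]
  gcongr
  exact (hS.tsum_alive_postWt_le hρ hP hD hV hα hα1 hβ hb).trans (ENNReal.ofReal_le_ofReal hT)

end

/-! ### The sensing rate and the second-order expansion -/

lemma chiSq_pos {A : Type*} {P Q : PMF A} (hac : AbsCont P Q) (hne : P ≠ Q) : 0 < chiSq P Q := by
  rw [pos_iff_ne_zero]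
  intro h0
  apply hne
  ext a
  rw [chiSq, ENNReal.tsum_eq_zero] at h0
  have h1 := h0 a
  by_cases hq : Q a = 0
  · rw [hq, hac a hq]
  · have hq' := ENNReal.toReal_pos hq (Q.apply_ne_top a)
    rw [ENNReal.ofReal_eq_zero] at h1
    have h2 : ((P a).toReal - (Q a).toReal) ^ 2 ≤ 0 := by
      have := (div_le_iff₀ hq').1 h1
      linarith
    have h3 : (P a).toReal - (Q a).toReal = 0 :=
      pow_eq_zero_iff (two_ne_zero) |>.1 (le_antisymm h2 (sq_nonneg _))
    rw [← ENNReal.toReal_eq_toReal_iff' (P.apply_ne_top a) (Q.apply_ne_top a)]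
    linarith

/-- The delay bound `(b + 2 Q / d) / (d + β D)`, expanded for the sensing rate
`β = √(k / S)`. Here `S = b + c₁` differs from `L = |ln α|` by a bounded amount `c`. -/
lemma delay_expansion_le {b Q d D k S L c c₁ : ℝ} (hb : 0 ≤ b) (hQ : 0 ≤ Q) (hd : 0 < d)
    (hD : 0 ≤ D) (hk : 0 ≤ k) (hc : 0 ≤ c) (hc₁ : 0 < c₁) (hS : S = b + c₁)
    (hβ : √(k / S) ≤ 1) (hSL : S ≤ L + c) (hLS : L ≤ S + c) :
    (b + 2 * (Q / d)) / (d + √(k / S) * D) ≤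
      L / d - D * √k / d ^ 2 * √L +
        (c / d + D / d ^ 2 * (√k * √c + c₁) + k * D ^ 2 / d ^ 3 + 2 * Q / d ^ 2) := by
  have hS0 : 0 < S := by linarith
  set β := √(k / S) with hβd
  have hβ0 : 0 ≤ β := Real.sqrt_nonneg _
  have hβS : β * S = √k * √S := by
    rw [hβd, Real.sqrt_div hk]
    have := Real.mul_self_sqrt hS0.le
    have h2 : √S ≠ 0 := (Real.sqrt_pos.2 hS0).ne'
    rw [div_mul_eq_mul_div, div_eq_iff h2, mul_assoc, this]
  have hββ : β ^ 2 * S = k := by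
    rw [hβd, Real.sq_sqrt (by positivity)]; field_simp
  have hsqrt : √L ≤ √S + √c :=
    by
    refine (Real.sqrt_le_sqrt hLS).trans (Real.sqrt_le_iff.2 ⟨by positivity, ?_⟩)
    nlinarith [Real.sq_sqrt hS0.le, Real.sq_sqrt hc,
      mul_nonneg (Real.sqrt_nonneg S) (Real.sqrt_nonneg c)]
  have h1 : √k * √L - √k * √c - c₁ ≤ b * β := by
    have e1 : b * β = √k * √S - β * c₁ := by rw [← hβS, hS]; ring
    have e2 : β * c₁ ≤ c₁ := mul_le_of_le_one_left hc₁.le hβ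
    have e3 : √k * √L ≤ √k * (√S + √c) := by gcongr
    rw [e1]; linarith
  have h2 : b * β ^ 2 ≤ k := by
    have : b * β ^ 2 ≤ S * β ^ 2 := by gcongr; linarith
    linarith
  have h3 : 1 / (d + β * D) ≤ 1 / d - β * D / d ^ 2 + β ^ 2 * D ^ 2 / d ^ 3 := by
    have hx : 0 ≤ β * D := by positivity
    rw [div_le_iff₀ (by positivity)]
    have : (1 / d - β * D / d ^ 2 + β ^ 2 * D ^ 2 / d ^ 3) * (d + β * D) =
      1 + (β * D) ^ 3 / d ^ 3 := by field_simp; ring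
    rw [this]
    have : 0 ≤ (β * D) ^ 3 / d ^ 3 := by positivity
    linarith
  have h4 : 1 / (d + β * D) ≤ 1 / d := by
    gcongr; linarith [mul_nonneg hβ0 hD]
  calc (b + 2 * (Q / d)) / (d + β * D)
      = b * (1 / (d + β * D)) + 2 * (Q / d) * (1 / (d + β * D)) := by ring
    _ ≤ b * (1 / d - β * D / d ^ 2 + β ^ 2 * D ^ 2 / d ^ 3) + 2 * (Q / d) * (1 / d) := by gcongr
    _ = b / d - D / d ^ 2 * (b * β) + (b * β ^ 2) * (D ^ 2 / d ^ 3) + 2 * Q / d ^ 2 := by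
        field_simp
    _ ≤ (L + c) / d - D / d ^ 2 * (√k * √L - √k * √c - c₁) + k * (D ^ 2 / d ^ 3) +
        2 * Q / d ^ 2 := by
        have : b ≤ L + c := by linarith
        gcongr
    _ = _ := by ring

/-- For small sensing rates the delay bound is below the one built into `rateTilde`: the time
saved by sensing outweighs the overshoot. -/
lemma delay_bound_le_budget {b Q d D β : ℝ} (hd : 0 < d) (hQ : 0 ≤ Q) (hβ : 0 ≤ β) (hD : 0 ≤ D)
    (h : Q ≤ b * β * D) : (b + 2 * (Q / d)) / (d + β * D) ≤ b / d + Q / d ^ 2 := by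
  rw [div_le_iff₀ (by positivity)]
  have h1 : (b / d + Q / d ^ 2) * (d + β * D) - (b + 2 * (Q / d)) =
      (b * β * D - Q + Q * β * D / d) / d := by field_simp; ring
  have h2 : 0 ≤ (b * β * D - Q + Q * β * D / d) / d := by
    have : 0 ≤ Q * β * D / d := by positivity
    exact div_nonneg (by linarith) hd.le
  linarith

section
variable [MeasurableSpace Y] [MeasurableSpace Z] [Countable Y] [Countable Z]
  [DiscreteMeasurableSpace Y] [DiscreteMeasurableSpace Z]

lemma expansion_eq (W : Channel Y Z) {ρ δ : ℝ} (hρ : ρ ∈ Set.Ioo (0 : ℝ) 1) (hδ : 0 < δ)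
    (α : ℝ) :
    expansion W ρ δ α = |Real.log α| / priorExp ρ - (gainD W).toReal *
      √(δ * priorExp ρ / (chi W true).toReal) / priorExp ρ ^ 2 * √|Real.log α| := by
  have hd := priorExp_pos hρ
  have h1 : priorExp ρ ^ (3 / 2 : ℝ) = priorExp ρ * √(priorExp ρ) := by
    rw [Real.sqrt_eq_rpow, ← Real.rpow_one_add' hd.le (by norm_num)]
    norm_num
  rw [expansion, h1, Real.sqrt_div (by positivity), Real.sqrt_mul hδ.le]
  have h2 := Real.mul_self_sqrt hd.le
  have h3 : √(priorExp ρ) ≠ 0 := (Real.sqrt_pos.2 hd).ne'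
  congr 2
  rw [show priorExp ρ ^ 2 = priorExp ρ * (√(priorExp ρ) * √(priorExp ρ)) by rw [h2]; ring]
  rcases eq_or_ne (√(chi W true).toReal) 0 with h0 | h0
  · rw [h0]; simp
  · field_simp

/-- The level `ln ((1 - α) / α) + C_ρ` to be passed by the logarithmic odds. -/
noncomputable def logLevel (ρ α : ℝ) : ℝ := |Real.log α| - |Real.log (1 - α)| + constC ρ

/-- The constant by which the denominator of `rateTilde` exceeds `χ_{2,1} / d` times `logLevel`,
in units of `χ_{2,1} / d`. -/
noncomputable def levelShift (W : Channel Y Z) (ρ : ℝ) : ℝ :=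
  priorExp ρ * ((chi W false).toReal / (ρ * (chi W true).toReal) +
    momentBound W ρ / priorExp ρ ^ 2)

lemma logLevel_eq {ρ α : ℝ} (hα : 0 < α) (hα1 : α < 1) :
    logLevel ρ α = Real.log ((1 - α) / α) + constC ρ := by
  have h1 := Real.log_neg hα hα1
  have h2 := Real.log_neg (by linarith : 0 < 1 - α) (by linarith)
  rw [logLevel, abs_of_neg h1, abs_of_neg h2, Real.log_div (by linarith) hα.ne']
  ring

/-- The denominator of `rateTilde`, with `momentBound / d² = M_over`. -/
lemma budget_eq (W : Channel Y Z) {ρ : ℝ} (hρ : ρ ∈ Set.Ioo (0 : ℝ) 1) (b : ℝ)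
    (hχ0 : 0 < (chi W true).toReal) :
    (chi W false).toReal / ρ + (chi W true).toReal *
        (b / priorExp ρ + momentBound W ρ / priorExp ρ ^ 2) =
      (chi W true).toReal / priorExp ρ * (b + levelShift W ρ) := by
  have hd := priorExp_pos hρ
  have hρ0 := hρ.1
  rw [levelShift]
  field_simp
  ring

lemma rateTilde_eq (W : Channel Y Z) {ρ : ℝ} (hρ : ρ ∈ Set.Ioo (0 : ℝ) 1) (δ α : ℝ)
    (hχ0 : 0 < (chi W true).toReal) :
    rateTilde W ρ δ α =
      √(δ * priorExp ρ / (chi W true).toReal / (logLevel ρ α + levelShift W ρ)) := by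
  have h := budget_eq W hρ (logLevel ρ α) hχ0
  rw [logLevel, momentBound] at h
  rw [rateTilde, constM, h, ← div_div, div_div_eq_mul_div, logLevel]

lemma tendsto_abs_log_nhdsGT_zero :
    Filter.Tendsto (fun α : ℝ => |Real.log α|) (𝓝[>] 0) Filter.atTop :=
  Filter.tendsto_abs_atBot_atTop.comp Real.tendsto_log_nhdsGT_zero

lemma tendsto_logLevel_add_div (ρ c : ℝ) :
    Filter.Tendsto (fun α : ℝ => (logLevel ρ α + c) / |Real.log α|) (𝓝[>] 0) (𝓝 1) := by
  have hL := tendsto_abs_log_nhdsGT_zero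
  have h1 : Filter.Tendsto (fun α : ℝ => |Real.log (1 - α)|) (𝓝[>] 0) (𝓝 0) := by
    have : ContinuousAt (fun α : ℝ => |Real.log (1 - α)|) 0 :=
      ((continuousAt_const.sub continuousAt_id).log (by norm_num)).abs
    have h2 := this.tendsto
    simp only [sub_zero, Real.log_one, abs_zero] at h2
    exact h2.mono_left nhdsWithin_le_nhds
  have h2 : Filter.Tendsto (fun α : ℝ => 1 + (- |Real.log (1 - α)| + (constC ρ + c)) / |Real.log α|)
      (𝓝[>] 0) (𝓝 (1 + 0)) :=
    tendsto_const_nhds.add (Filter.Tendsto.div_atTop (h1.neg.add_const _) hL)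
  rw [add_zero] at h2
  refine h2.congr' ?_
  filter_upwards [hL.eventually_gt_atTop 0] with α hα
  rw [logLevel]
  field_simp
  ring

lemma rateTilde_isEquivalent (W : Channel Y Z) {ρ δ : ℝ} (hρ : ρ ∈ Set.Ioo (0 : ℝ) 1)
    (hδ : 0 < δ) (hχ0 : 0 < (chi W true).toReal) :
    (fun α => rateTilde W ρ δ α) ~[𝓝[>] (0 : ℝ)]
      fun α => Real.sqrt (δ * priorExp ρ / ((chi W true).toReal * |Real.log α|)) := by
  have hd := priorExp_pos hρ
  have hL := tendsto_abs_log_nhdsGT_zero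
  rw [Asymptotics.isEquivalent_iff_tendsto_one]
  · have h1 := ((tendsto_logLevel_add_div ρ (levelShift W ρ)).inv₀ one_ne_zero).sqrt
    rw [inv_one, Real.sqrt_one] at h1
    refine h1.congr' ?_
    filter_upwards [hL.eventually_gt_atTop 0] with α hα
    rw [Pi.div_apply, rateTilde_eq W hρ δ α hχ0, ← Real.sqrt_div' _ (by positivity)]
    congr 1
    rw [inv_div]
    field_simp
  · filter_upwards [hL.eventually_gt_atTop 0] with α hα
    exact (Real.sqrt_pos.2 (by positivity)).ne'

/-- The constant in the upper bound for the delay of the Shiryaev policy. -/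
noncomputable def delayConst (W : Channel Y Z) (ρ δ : ℝ) : ℝ :=
  (1 + |constC ρ| + levelShift W ρ) / priorExp ρ +
    (gainD W).toReal / priorExp ρ ^ 2 *
      (√(δ * priorExp ρ / (chi W true).toReal) * √(1 + |constC ρ| + levelShift W ρ) +
        levelShift W ρ) +
    δ * priorExp ρ / (chi W true).toReal * (gainD W).toReal ^ 2 / priorExp ρ ^ 3 +
    2 * momentBound W ρ / priorExp ρ ^ 2

lemma abs_log_one_sub_le {α : ℝ} (hα : 0 < α) (hα2 : α < 1 / 2) : |Real.log (1 - α)| ≤ 1 := by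
  have h2 := Real.log_neg (by linarith : 0 < 1 - α) (by linarith)
  rw [abs_of_neg h2]
  have h3 := Real.one_sub_inv_le_log_of_pos (by linarith : 0 < 1 - α)
  have h4 : (1 - α)⁻¹ ≤ 2 := by
    rw [inv_le_comm₀ (by linarith) (by norm_num)]; linarith
  linarith

/-- The constraints and the delay of the constant-rate Shiryaev policy, for small `α`. -/
lemma eventually_shiryaev {W : Channel Y Z} {ρ δ : ℝ} (hρ : ρ ∈ Set.Ioo (0 : ℝ) 1)
    (hχ : ∀ θ, chi W θ < ∞) (hχ0 : 0 < (chi W true).toReal)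
    (hP : aliceChannel W false true = aliceChannel W false false)
    (hD_pos : 0 < gainD W) (hD : gainD W < ∞) (hV : gainV W < ∞) (hδ : 0 < δ) :
    ∀ᶠ α in 𝓝[>] (0 : ℝ), ∀ pol : Policy Y, IsShiryaev W ρ α (rateStar W ρ δ α) pol →
      ECB W ρ pol ≤ ENNReal.ofReal δ ∧ PFA W ρ pol ≤ ENNReal.ofReal α ∧
        ADD W ρ pol < ∞ ∧
        (ADD W ρ pol).toReal ≤ expansion W ρ δ α + (delayConst W ρ δ + 1) := by
  have hd := priorExp_pos hρ
  have hρ0 := hρ.1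
  have hac := absCont_of_toMeasure (absolutelyContinuous_of_gainD hD)
  have hD0 : 0 < (gainD W).toReal := ENNReal.toReal_pos hD_pos.ne' hD.ne
  have hV0 : 0 ≤ (gainV W).toReal := ENNReal.toReal_nonneg
  have hQ : 0 < momentBound W ρ := by unfold momentBound; positivity
  have hs : 0 < levelShift W ρ := by
    have : 0 ≤ (chi W false).toReal := ENNReal.toReal_nonneg
    unfold levelShift; positivity
  have hL := tendsto_abs_log_nhdsGT_zero
  set k := δ * priorExp ρ / (chi W true).toReal with hk
  have hk0 : 0 < k := by positivity
  set D := (gainD W).toReal with hDd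
  set d := priorExp ρ with hdd
  set Q := momentBound W ρ with hQd
  set s := levelShift W ρ with hsd
  filter_upwards [Ioo_mem_nhdsGT (by norm_num : (0 : ℝ) < 1 / 2),
    hL.eventually_ge_atTop (1 + |constC ρ| + k + ((Q / D + s) / √k) ^ 2)]
    with α ⟨hα, hα2⟩ hLα pol hS
  set L := |Real.log α| with hLd
  have hα1 : α < 1 := by linarith
  have h1 := abs_log_one_sub_le hα hα2
  have h1' := abs_nonneg (Real.log (1 - α))
  have hC1 := neg_abs_le (constC ρ)
  have hC2 := le_abs_self (constC ρ)
  set b := logLevel ρ α with hb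
  have hbL : b = L - |Real.log (1 - α)| + constC ρ := rfl
  have hsq : 0 ≤ ((Q / D + s) / √k) ^ 2 := sq_nonneg _
  have hb0 : 0 ≤ b := by linarith
  have hb0' : 0 ≤ Real.log ((1 - α) / α) + constC ρ := by rwa [← logLevel_eq hα hα1]
  have hS0 : 0 < b + s := by linarith
  have hrate : rateTilde W ρ δ α = √(k / (b + s)) := rateTilde_eq W hρ δ α hχ0
  have hrate1 : √(k / (b + s)) ≤ 1 := by
    refine (Real.sqrt_le_sqrt ((div_le_one hS0).2 ?_)).trans_eq Real.sqrt_one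
    linarith
  have hstar : rateStar W ρ δ α = √(k / (b + s)) := by
    rw [rateStar, hrate, min_eq_right hrate1]
  rw [hstar] at hS
  set β := √(k / (b + s)) with hβ
  have hβ0 : 0 ≤ β := Real.sqrt_nonneg _
  have hβI : β ∈ Set.Icc (0 : ℝ) 1 := ⟨hβ0, hrate1⟩
  -- `b β ≥ √k √(b + s) - s` exceeds `Q / D` for small `α`
  have hβb : Q ≤ b * β * D := by
    have hkp : 0 < √k := Real.sqrt_pos.2 hk0
    have e1 : (Q / D + s) / √k ≤ √(b + s) := Real.le_sqrt_of_sq_le (by linarith)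
    rw [div_le_iff₀ hkp] at e1
    have e2 : β * (b + s) = √k * √(b + s) := by
      have h2 : √(b + s) ≠ 0 := (Real.sqrt_pos.2 hS0).ne'
      rw [hβ, Real.sqrt_div hk0.le, div_mul_eq_mul_div, div_eq_iff h2, mul_assoc,
        Real.mul_self_sqrt hS0.le]
    have e3 : β * s ≤ s := mul_le_of_le_one_left hs.le hrate1
    have e4 : Q / D ≤ b * β := by linarith
    rwa [div_le_iff₀ hD0] at e4
  have hbudget := delay_bound_le_budget hd hQ.le hβ0 hD0.le hβb
  have hββ : β ^ 2 = k / (b + s) := Real.sq_sqrt (by positivity)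
  refine ⟨?_, hS.PFA_le hρ hP hac hα, ?_⟩
  · refine (hS.ECB_le hρ hP hD hV hχ hα hα1 hβI hb0' (T := b / d + Q / d ^ 2) (by positivity)
      ?_).trans (ENNReal.ofReal_le_ofReal ?_)
    · rwa [← logLevel_eq hα hα1]
    · rw [budget_eq W hρ b hχ0, hββ, hk, ← hdd, ← hsd]
      apply le_of_eq
      field_simp
  · have hA := hS.ADD_le hρ hP hD hV hα hα1 hβI hb0'
    rw [← logLevel_eq hα hα1] at hA
    have hT : 0 ≤ (b + 2 * (Q / d)) / (d + β * D) := by positivity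
    refine ⟨lt_of_le_of_lt hA (by finiteness), ?_⟩
    have hA' : (ADD W ρ pol).toReal ≤ (b + 2 * (Q / d)) / (d + β * D) + 1 := by
      refine ENNReal.toReal_le_of_le_ofReal (by positivity) (hA.trans ?_)
      rw [ENNReal.ofReal_add hT zero_le_one, ENNReal.ofReal_one]
    have hexp := delay_expansion_le (L := L) (c := 1 + |constC ρ| + s) hb0 hQ.le hd hD0.le hk0.le
      (by positivity) hs rfl hrate1 (by linarith) (by linarith)
    rw [expansion_eq W hρ hδ, delayConst]
    linarith

/-- The lower bound for the delay of all policies meeting both constraints. -/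
lemma expansion_sub_le_ADD {W : Channel Y Z} {ρ δ α : ℝ} (hρ : ρ ∈ Set.Ioo (0 : ℝ) 1)
    (hχ : chi W true < ∞) (hχ0 : 0 < (chi W true).toReal)
    (hP : aliceChannel W false true = aliceChannel W false false)
    (hD : gainD W < ∞) (hδ : 0 < δ) (hα : 0 < α) (hα1 : α < 1) (pol : Policy Y)
    (hE : ECB W ρ pol ≤ ENNReal.ofReal δ) (hF : PFA W ρ pol ≤ ENNReal.ofReal α) :
    ENNReal.ofReal (expansion W ρ δ α - 1 / ρ) ≤ ADD W ρ pol := by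
  rcases eq_or_ne (ADD W ρ pol) ∞ with hA | hA
  · rw [hA]; exact le_top
  rw [ENNReal.ofReal_le_iff_le_toReal hA, expansion_eq W hρ hδ]
  have hd := priorExp_pos hρ
  have hρ0 := hρ.1
  have h1ρ : 0 < 1 - ρ := by linarith [hρ.2]
  have hD0 : 0 ≤ (gainD W).toReal := ENNReal.toReal_nonneg
  have hLpos : 0 < |Real.log α| := abs_pos.2 (Real.log_neg hα hα1).ne
  have hlog : Real.log α = -|Real.log α| := by
    rw [abs_of_neg (Real.log_neg hα hα1), neg_neg]
  set L := |Real.log α| with hL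
  set k := δ * priorExp ρ / (chi W true).toReal with hk
  have hk0 : 0 < k := by positivity
  set A := (ADD W ρ pol).toReal
  -- a delay of at least `L / d` leaves nothing to prove
  by_cases hAL : L / priorExp ρ ≤ A
  · have : 0 ≤ (gainD W).toReal * √k / priorExp ρ ^ 2 * √L := by positivity
    have : 0 ≤ 1 / ρ := by positivity
    linarith
  · have hsk : 0 < √k := Real.sqrt_pos.2 hk0
    have hsL : 0 < √L := Real.sqrt_pos.2 hLpos
    have hkk := Real.mul_self_sqrt hk0.le
    have hLL := Real.mul_self_sqrt hLpos.le
    -- this `l` balances the two terms when the delay is `L / d`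
    have h := delay_converse hρ hP hD hχ hχ0 pol (l := √L / √k) hα hδ (by positivity)
      (lt_top_iff_ne_top.2 hA) hE hF
    rw [Real.log_div hα.ne' h1ρ.ne', hlog] at h
    have e1 : √L / √k * δ / (2 * (chi W true).toReal) = √k * √L / (2 * priorExp ρ) := by
      have : δ = k * (chi W true).toReal / priorExp ρ := by rw [hk]; field_simp
      rw [this]
      field_simp
      linarith
    have e2 : A / (2 * (√L / √k)) ≤ √k * √L / (2 * priorExp ρ) := by
      calc A / (2 * (√L / √k)) ≤ (L / priorExp ρ) / (2 * (√L / √k)) := by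
            gcongr; exact (not_le.1 hAL).le
        _ = _ := by
            field_simp
            linarith
    rw [e1] at h
    have e3 : (gainD W).toReal * (√k * √L / (2 * priorExp ρ) + A / (2 * (√L / √k))) ≤
        (gainD W).toReal * (√k * √L / priorExp ρ) := by
      gcongr
      have : √k * √L / priorExp ρ = √k * √L / (2 * priorExp ρ) + √k * √L / (2 * priorExp ρ) := by
        field_simp; norm_num
      linarith
    have h5 : L - priorExp ρ ≤ priorExp ρ * (A + (1 - ρ) / ρ) +
        (gainD W).toReal * (√k * √L / priorExp ρ) := by
      have := priorExp_eq hρ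
      linarith
    have h6 : L / priorExp ρ - (gainD W).toReal * √k / priorExp ρ ^ 2 * √L - 1 / ρ - A =
        (L - priorExp ρ - (priorExp ρ * (A + (1 - ρ) / ρ) +
          (gainD W).toReal * (√k * √L / priorExp ρ))) / priorExp ρ := by
      field_simp; ring
    have h7 := div_nonpos_of_nonpos_of_nonneg (sub_nonpos.2 h5) hd.le
    linarith

end

end CovertQCD

theorem mainTheorem2 {Y Z : Type*} [MeasurableSpace Y] [MeasurableSpace Z]
    [Countable Y] [Countable Z] [DiscreteMeasurableSpace Y] [DiscreteMeasurableSpace Z]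
    (W : Channel Y Z) (ρ : ℝ) (hρ : ρ ∈ Set.Ioo (0 : ℝ) 1)
    -- Eve's observation channel: `Q¹_θ ≪ Q⁰_θ`, `Q¹_θ ≠ Q⁰_θ`, `χ_{2,θ} < ∞`
    (hQ_ac : ∀ θ, AbsCont (eveChannel W true θ) (eveChannel W false θ))
    (hQ_ne : ∀ θ, eveChannel W true θ ≠ eveChannel W false θ)
    (hχ : ∀ θ, chi W θ < ∞)
    -- no free passive sensing: `P⁰₁ = P⁰₀`
    (hP : aliceChannel W false true = aliceChannel W false false)
    -- active sensing has nonzero but finite gain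
    (hD_pos : 0 < gainD W) (hD_fin : gainD W < ∞) (hV : gainV W < ∞)
    (δ : ℝ) (hδ : 0 < δ) :
    -- first-order behaviour of the sensing rate
    ((fun α => rateTilde W ρ δ α) ~[𝓝[>] (0 : ℝ)]
      fun α => Real.sqrt (δ * priorExp ρ / ((chi W true).toReal * |Real.log α|))) ∧
    ∃ C α₀ : ℝ, 0 < α₀ ∧ ∀ α : ℝ, 0 < α → α < α₀ →
      -- the policy exists,
      (∃ pol : Policy Y, IsShiryaev W ρ α (rateStar W ρ δ α) pol) ∧
      -- it meets both constraints and achieves the expansion of the delay,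
      (∀ pol : Policy Y, IsShiryaev W ρ α (rateStar W ρ δ α) pol →
        ECB W ρ pol ≤ ENNReal.ofReal δ ∧ PFA W ρ pol ≤ ENNReal.ofReal α ∧
        ADD W ρ pol < ∞ ∧ (ADD W ρ pol).toReal ≤ expansion W ρ δ α + C) ∧
      -- and no policy that meets both constraints does better up to a bounded term
      (∀ pol : Policy Y, ECB W ρ pol ≤ ENNReal.ofReal δ → PFA W ρ pol ≤ ENNReal.ofReal α →
        ENNReal.ofReal (expansion W ρ δ α - C) ≤ ADD W ρ pol) := by
  have hχ0 : 0 < (chi W true).toReal :=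
    ENNReal.toReal_pos (chiSq_pos (hQ_ac true) (hQ_ne true)).ne' (hχ true).ne
  have hac := absCont_of_toMeasure (absolutelyContinuous_of_gainD hD_fin)
  refine ⟨rateTilde_isEquivalent W hρ hδ hχ0, max (delayConst W ρ δ + 1) (1 / ρ), ?_⟩
  obtain ⟨α₀, hα₀, h⟩ := mem_nhdsGT_iff_exists_Ioo_subset.1
    (eventually_shiryaev hρ hχ hχ0 hP hD_pos hD_fin hV hδ)
  refine ⟨min α₀ 1, lt_min hα₀ one_pos, fun α hα hα' => ⟨?_, ?_, ?_⟩⟩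
  · exact exists_isShiryaev W hρ hP hac (hα'.trans_le (min_le_right _ _))
      ⟨le_min zero_le_one (Real.sqrt_nonneg _), min_le_left _ _⟩
  · intro pol hpol
    obtain ⟨h1, h2, h3, h4⟩ := h ⟨hα, hα'.trans_le (min_le_left _ _)⟩ pol hpol
    exact ⟨h1, h2, h3, h4.trans (by gcongr; exact le_max_left _ _)⟩
  · intro pol hE hF
    refine le_trans (ENNReal.ofReal_le_ofReal ?_) (expansion_sub_le_ADD hρ (hχ true) hχ0 hP hD_fin
      hδ hα (hα'.trans_le (min_le_right _ _)) pol hE hF)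
    gcongr
    exact le_max_right _ _
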